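/- Let $I\subseteq(0,\infty)$ have $0$ as a limit point. A perturbation is a family $(p_\epsilon)_{\epsilon\in I}$ of transition matrices of Markov chains on one finite non-empty state space $S$. A state $x$ is stochastically stable if there are stationary distributions $\mu_\epsilon$ of $p_\epsilon$ ($\epsilon\in I$) with $\liminf_{\epsilon\to0}\mu_\epsilon(x)>0$. For $f,g:I\to[0,1]$ write $f\precsim g$ if $f\in O(g)$ as $\epsilon\to0$ in $I$, and $f\cong g$ if $f\precsim g$ and $g\precsim f$; let $[f]$ be the $\cong$-class of $f$. Multiplication and $\precsim$ pass to classes. For $f\precsim g$ the ordered division is $[f]\div[g]:=[h]$, where $h=\min(1,f/g)$ where $g\neq0$ and $h=1$ where $g=0$. Consider perturbations such that $f\precsim g$ or $g\precsim f$ for all $f,g$ in the multiplicative closure of the maps $\epsilon\mapsto p_\epsilon(x,y)$ with $x\neq y$. 1. Every such perturbation has a stochastically stable state. 2. Stability can be decided in $O(n^3)$, where $n=|S|$: there are one program and one constant $C$ such that for every such perturbation, with any numbering of its $n$ states, the program, given $n$ and the matrix of the classes $[\epsilon\mapsto p_\epsilon(x,y)]$, halts within $C\,n^3$ steps and has marked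 exactly the stochastically stable states. Programs use natural-number variables and arrays (with successor, predecessor and comparison) and two-dimensional arrays of classes; copying a class, the constants $[0]$ and $[1]$, the test $[f]\precsim[g]$, the product of two classes, and the ordered division $[f]\div[g]$ when $[f]\precsim[g]$ cost one step each. -/

import Mathlib

open Filter Topology Asymptotics

/-- The filter "`ε → 0` with `ε` ranging over `I`". -/
def towardsZero (I : Set ℝ) : Filter I := comap (fun ε : I => (ε : ℝ)) (𝓝 0)

/-- A perturbation: a family, indexed by a set `I` of positive reals having `0` as a limit point,
of (transition matrices of) Markov chains on a common finite state space `S`. -/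
structure Perturbation (I : Set ℝ) (S : Type*) [Fintype S] [DecidableEq S] where
  index_pos : ∀ ε ∈ I, 0 < ε
  index_limit : AccPt (0 : ℝ) (𝓟 I)
  P : I → Matrix S S ℝ
  stochastic : ∀ ε, P ε ∈ Matrix.rowStochastic ℝ S

/-- `μ` is a stationary distribution of the transition matrix `A`. -/
def IsStationaryDistribution {S : Type*} [Fintype S] (A : Matrix S S ℝ) (μ : S → ℝ) : Prop :=
  μ ∈ stdSimplex ℝ S ∧ Matrix.vecMul μ A = μ

/-- Big-O domination, as `ε → 0` in `I`, between functions `I → [0,1]`. -/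
def Dominated {I : Set ℝ} (f g : I → unitInterval) : Prop :=
  (fun ε => (f ε : ℝ)) =O[towardsZero I] (fun ε => (g ε : ℝ))

namespace Perturbation

variable {I : Set ℝ} {S : Type*} [Fintype S] [DecidableEq S]

/-- The transition map `ε ↦ p_ε(x, y)`. -/
def trans (p : Perturbation I S) (x y : S) : I → unitInterval := fun ε =>
  ⟨p.P ε x y, Matrix.nonneg_of_mem_rowStochastic (p.stochastic ε),
    Matrix.le_one_of_mem_rowStochastic (p.stochastic ε)⟩

/-- Stochastic stability of a state. -/
def IsStable (p : Perturbation I S) (x : S) : Prop :=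
  ∃ μ : I → S → ℝ, (∀ ε, IsStationaryDistribution (p.P ε) (μ ε)) ∧
    0 < liminf (fun ε => μ ε x) (towardsZero I)

/-- The multiplicative closure of the transition maps between distinct states. -/
def mulClosure (p : Perturbation I S) : Subsemigroup (I → unitInterval) :=
  Subsemigroup.closure {f | ∃ x y, x ≠ y ∧ f = p.trans x y}

/-- Any two members of the multiplicative closure are comparable for big-O. -/
def TotallyPreordered (p : Perturbation I S) : Prop :=
  ∀ f ∈ p.mulClosure, ∀ g ∈ p.mulClosure, Dominated f g ∨ Dominated g f

end Perturbation

/-! ### Functions `I → [0,1]` up to mutual big-O domination -/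

theorem Dominated.refl {I : Set ℝ} (f : I → unitInterval) : Dominated f f := isBigO_refl _ _

theorem Dominated.trans {I : Set ℝ} {f g h : I → unitInterval} (h₁ : Dominated f g)
    (h₂ : Dominated g h) : Dominated f h := IsBigO.trans h₁ h₂

theorem Dominated.mul {I : Set ℝ} {f f' g g' : I → unitInterval} (h₁ : Dominated f f')
    (h₂ : Dominated g g') : Dominated (f * g) (f' * g') := IsBigO.mul h₁ h₂

/-- Mutual domination. -/
def asympSetoid (I : Set ℝ) : Setoid (I → unitInterval) where
  r f g := Dominated f g ∧ Dominated g f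
  iseqv := ⟨fun f => ⟨.refl f, .refl f⟩, fun h => ⟨h.2, h.1⟩,
    fun h k => ⟨h.1.trans k.1, k.2.trans h.2⟩⟩

/-- Equivalence classes of functions `I → [0,1]` for mutual domination. -/
def AsympClass (I : Set ℝ) : Type := Quotient (asympSetoid I)

/-- Ordered division: `f / g` where `g` does not vanish, and `1` where `g` vanishes. It is used
only if `f` is dominated by `g`; then `f / g` is bounded near `0`, and capping it at `1` keeps its
values in `[0,1]` without changing its class. -/
noncomputable def orderedDiv {I : Set ℝ} (f g : I → unitInterval) : I → unitInterval := fun ε =>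
  if g ε = 0 then 1 else
    ⟨min 1 ((f ε : ℝ) / g ε), le_min zero_le_one (div_nonneg (f ε).2.1 (g ε).2.1), min_le_left _ _⟩

theorem Dominated.orderedDiv {I : Set ℝ} {f f' g g' : I → unitInterval} (h₁ : Dominated f f')
    (h₂ : Dominated g g') (h₃ : Dominated g' g) :
    Dominated (orderedDiv f g) (orderedDiv f' g') := by
  obtain ⟨a, ha, h₁⟩ := IsBigO.exists_pos h₁
  obtain ⟨b, hb, h₃⟩ := IsBigO.exists_pos h₃
  obtain ⟨c, hc, h₂⟩ := IsBigO.exists_pos h₂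
  refine IsBigO.of_bound (max 1 (a * b)) ?_
  filter_upwards [h₁.bound, h₂.bound, h₃.bound] with ε e₁ e₂ e₃
  have nn : ∀ x : unitInterval, ‖(x : ℝ)‖ = x := fun x => Real.norm_of_nonneg x.2.1
  simp only [nn] at e₁ e₂ e₃ ⊢
  have pos : ∀ x : unitInterval, x ≠ 0 → 0 < (x : ℝ) := fun x hx =>
    lt_of_le_of_ne x.2.1 (fun h => hx (Subtype.ext h.symm))
  have zero_of : ∀ x : unitInterval, (x : ℝ) ≤ 0 → x = 0 := fun x hx =>
    Subtype.ext (le_antisymm hx x.2.1)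
  by_cases hg : g ε = 0
  · have hg' : g' ε = 0 := zero_of _ (by simpa [hg] using e₃)
    simp [_root_.orderedDiv, hg, hg']
  · have hg' : g' ε ≠ 0 := fun h => hg (zero_of _ (by simpa [h] using e₂))
    have p := pos _ hg
    have p' := pos _ hg'
    simp only [_root_.orderedDiv, hg, hg', if_false]
    rw [mul_min_of_nonneg _ _ (le_trans zero_le_one (le_max_left _ _)), mul_one]
    refine le_min ((min_le_left _ _).trans (le_max_left _ _)) ((min_le_right _ _).trans ?_)
    have hf' := (f' ε).2.1
    calc (f ε : ℝ) / g ε ≤ (a * b) * ((f' ε : ℝ) / g' ε) := by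
          rw [div_le_iff₀ p, mul_div_assoc', div_mul_eq_mul_div, le_div_iff₀ p']
          calc (f ε : ℝ) * g' ε ≤ (a * f' ε) * (b * g ε) :=
                mul_le_mul e₁ e₃ p'.le (mul_nonneg ha.le hf')
            _ = a * b * f' ε * g ε := by ring
      _ ≤ _ := mul_le_mul_of_nonneg_right (le_max_right _ _) (div_nonneg hf' p'.le)

namespace AsympClass

variable {I : Set ℝ}

/-- The class of a function. -/
def mk (f : I → unitInterval) : AsympClass I := Quotient.mk (asympSetoid I) f

instance : Zero (AsympClass I) := ⟨mk 0⟩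

instance : One (AsympClass I) := ⟨mk 1⟩

instance : LE (AsympClass I) :=
  ⟨Quotient.lift₂ Dominated fun _ _ _ _ h k => propext
    ⟨fun d => h.2.trans (d.trans k.1), fun d => h.1.trans (d.trans k.2)⟩⟩

instance : Mul (AsympClass I) :=
  ⟨Quotient.map₂ (· * ·) fun _ _ h _ _ k => ⟨h.1.mul k.1, h.2.mul k.2⟩⟩

noncomputable instance : Div (AsympClass I) :=
  ⟨Quotient.map₂ orderedDiv fun _ _ h _ _ k =>
    ⟨h.1.orderedDiv k.1 k.2, h.2.orderedDiv k.2 k.1⟩⟩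

end AsympClass

/-! ### A machine model

Imperative programs over natural-number variables, natural-number arrays and two-dimensional arrays
of weights. The arithmetic on numbers is limited to successor and predecessor, so numbers stay
linear in the running time. Weights can only be copied, compared, multiplied and divided.
A program does not mention the weights, so that one program serves all inputs. -/

namespace Machine

/-- Expressions for natural numbers: literals, variables, array cells, successor, predecessor. -/
inductive NatExp where
  | lit (k : ℕ)
  | var (x : ℕ)
  | arr (a : ℕ) (i : NatExp)
  | succ (e : NatExp)
  | pred (e : NatExp)

/-- The cell in row `row` and column `col` of the weight matrix number `a`. -/
structure Cell where
  a : ℕ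
  row : NatExp
  col : NatExp

/-- Right-hand sides of weight assignments. -/
inductive WExp where
  | zero
  | one
  | get (c : Cell)
  | mul (c d : Cell)
  | div (c d : Cell)

inductive Test where
  | eq (e₁ e₂ : NatExp)
  | lt (e₁ e₂ : NatExp)
  | wle (c d : Cell)
  | not (b : Test)
  | and (b₁ b₂ : Test)

inductive Cmd where
  | skip
  | set (x : ℕ) (e : NatExp)
  | store (a : ℕ) (i e : NatExp)
  | wset (c : Cell) (v : WExp)
  | seq (c₁ c₂ : Cmd)
  | ite (b : Test) (c₁ c₂ : Cmd)
  | while (b : Test) (c : Cmd)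

/-- Memory contents: variables, arrays, and weight matrices. -/
structure Memory (W : Type*) where
  var : ℕ → ℕ
  arr : ℕ → ℕ → ℕ
  mat : ℕ → ℕ → ℕ → W

variable {W : Type*}

def NatExp.eval (m : Memory W) : NatExp → ℕ
  | .lit k => k
  | .var x => m.var x
  | .arr a i => m.arr a (i.eval m)
  | .succ e => e.eval m + 1
  | .pred e => e.eval m - 1

def Cell.eval (m : Memory W) (c : Cell) : W := m.mat c.a (c.row.eval m) (c.col.eval m)

/-- `v.Eval m w`: the right-hand side `v` has the value `w`. A division `c / d` has a value only if
`c ≤ d`. -/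
inductive WExp.Eval [LE W] [Zero W] [One W] [Mul W] [Div W] (m : Memory W) : WExp → W → Prop
  | zero : WExp.Eval m .zero 0
  | one : WExp.Eval m .one 1
  | get (c : Cell) : WExp.Eval m (.get c) (c.eval m)
  | mul (c d : Cell) : WExp.Eval m (.mul c d) (c.eval m * d.eval m)
  | div (c d : Cell) : c.eval m ≤ d.eval m → WExp.Eval m (.div c d) (c.eval m / d.eval m)

def Test.Holds [LE W] (m : Memory W) : Test → Prop
  | .eq e₁ e₂ => e₁.eval m = e₂.eval m
  | .lt e₁ e₂ => e₁.eval m < e₂.eval m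
  | .wle c d => c.eval m ≤ d.eval m
  | .not b => ¬ b.Holds m
  | .and b₁ b₂ => b₁.Holds m ∧ b₂.Holds m

/-- Assign the value `v` to the variable `x`. -/
def Memory.set (m : Memory W) (x v : ℕ) : Memory W :=
  ⟨Function.update m.var x v, m.arr, m.mat⟩

/-- Write `v` to position `i` of the array `a`. -/
def Memory.store (m : Memory W) (a i v : ℕ) : Memory W :=
  ⟨m.var, Function.update m.arr a (Function.update (m.arr a) i v), m.mat⟩

/-- Write `w` to position `(i, j)` of the weight matrix `a`. -/
def Memory.wset (m : Memory W) (a i j : ℕ) (w : W) : Memory W :=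
  ⟨m.var, m.arr, Function.update m.mat a
    (Function.update (m.mat a) i (Function.update (m.mat a i) j w))⟩

/-- `Exec c m t m'`: the command `c`, started in memory `m`, halts after `t` steps in memory `m'`.
Each assignment and each evaluation of a test is one step (expressions of a fixed program have
bounded size). -/
inductive Exec [LE W] [Zero W] [One W] [Mul W] [Div W] : Cmd → Memory W → ℕ → Memory W → Prop
  | skip (m) : Exec .skip m 1 m
  | set (m) (x : ℕ) (e : NatExp) : Exec (.set x e) m 1 (m.set x (e.eval m))
  | store (m) (a : ℕ) (i e : NatExp) : Exec (.store a i e) m 1 (m.store a (i.eval m) (e.eval m))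
  | wset {m} (c : Cell) {v : WExp} {w : W} : v.Eval m w →
      Exec (.wset c v) m 1 (m.wset c.a (c.row.eval m) (c.col.eval m) w)
  | seq {c₁ c₂ m₁ m₂ m₃ t₁ t₂} : Exec c₁ m₁ t₁ m₂ → Exec c₂ m₂ t₂ m₃ →
      Exec (.seq c₁ c₂) m₁ (t₁ + t₂) m₃
  | ite_true {b c₁ c₂ m m' t} : b.Holds m → Exec c₁ m t m' → Exec (.ite b c₁ c₂) m (t + 1) m'
  | ite_false {b c₁ c₂ m m' t} : ¬ b.Holds m → Exec c₂ m t m' → Exec (.ite b c₁ c₂) m (t + 1) m'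
  | while_false {b c m} : ¬ b.Holds m → Exec (.while b c) m 1 m
  | while_true {b c m₁ m₂ m₃ t₁ t₂} : b.Holds m₁ → Exec c m₁ t₁ m₂ →
      Exec (.while b c) m₂ t₂ m₃ → Exec (.while b c) m₁ (t₁ + t₂ + 1) m₃

/-- Runs are deterministic. -/
theorem Exec.deterministic [LE W] [Zero W] [One W] [Mul W] [Div W] {c : Cmd} {m m₁ m₂ : Memory W}
    {t₁ t₂ : ℕ} (h₁ : Exec c m t₁ m₁) (h₂ : Exec c m t₂ m₂) : t₁ = t₂ ∧ m₁ = m₂ := by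
  induction h₁ generalizing t₂ m₂ with
  | skip m => cases h₂; exact ⟨rfl, rfl⟩
  | set => cases h₂; exact ⟨rfl, rfl⟩
  | store => cases h₂; exact ⟨rfl, rfl⟩
  | wset c hv => cases h₂ with
    | wset _ hv' => cases hv <;> cases hv' <;> exact ⟨rfl, rfl⟩
  | seq _ _ ih₁ ih₂ => cases h₂ with
    | seq k₁ k₂ =>
      obtain ⟨rfl, rfl⟩ := ih₁ k₁
      obtain ⟨rfl, rfl⟩ := ih₂ k₂
      exact ⟨rfl, rfl⟩
  | ite_true hb _ ih => cases h₂ with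
    | ite_true _ k => obtain ⟨rfl, rfl⟩ := ih k; exact ⟨rfl, rfl⟩
    | ite_false hb' _ => exact absurd hb hb'
  | ite_false hb _ ih => cases h₂ with
    | ite_true hb' _ => exact absurd hb' hb
    | ite_false _ k => obtain ⟨rfl, rfl⟩ := ih k; exact ⟨rfl, rfl⟩
  | while_false hb => cases h₂ with
    | while_false => exact ⟨rfl, rfl⟩
    | while_true hb' => exact absurd hb' hb
  | while_true hb _ _ ih₁ ih₂ => cases h₂ with
    | while_false hb' => exact absurd hb hb'
    | while_true _ k₁ k₂ =>
      obtain ⟨rfl, rfl⟩ := ih₁ k₁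
      obtain ⟨rfl, rfl⟩ := ih₂ k₂
      exact ⟨rfl, rfl⟩

/-- The initial memory for an `n × n` weight matrix `A`: variable `0` holds `n`, matrix `0` holds
`A`, and everything else is zero. -/
def input [Zero W] {n : ℕ} (A : Fin n → Fin n → W) : Memory W where
  var x := if x = 0 then n else 0
  arr _ _ := 0
  mat a i j := if h : a = 0 ∧ i < n ∧ j < n then A ⟨i, h.2.1⟩ ⟨j, h.2.2⟩ else 0

end Machine

/-! Stationary distributions depend only on the off-diagonal rates, and these only up to a common
positive factor. Watching the process outside a state `u` reroutes each jump into `u` along the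
jumps out of `u`. After multiplication by the exit rate of `u`, the new rates (`eliminate`) are sums
of products, without division. Stationary distributions pass back and forth by
`IsStationaryOn.restrict` and `IsStationaryOn.extend`.

Let `u → v` be a jump of maximal order. Then `u` is left as fast as anything else happens, so its
weight is at most a bounded multiple of the total weight elsewhere, and eliminating it preserves the
stability or instability of all other states (`IsPivot.stableOn_eliminate_iff`). The state `u`
itself is stable exactly if some stable state jumps to it at maximal order
(`IsPivot.stableOn_left_iff`). One direction is that weight propagates along maximal jumps. For the
other, if `u` is stable but not reached from `v` by maximal jumps, then the set reached from `v`
receives a flow of maximal order and can release only a flow of smaller order, which contradicts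
equilibrium.

Orders of magnitude suffice for this computation. The exit rate has the order of the pivot rate, and
a sum of two nonnegative comparable terms has the order of the larger one. The order of each new
rate is therefore that of a product of old ones (`Represents.eliminate`), so everything stays in the
multiplicative closure, where comparability is assumed; ordered division is never needed.

Eliminating down to one state, which is trivially stable, and going back gives existence
(`Represents.exists_stableOn`). Recording the pivots and reading them backwards gives the algorithm
(`Machine.runs_markStable`), with a quadratic cost for each eliminated state. -/

/-! ### Stationary distributions of jump rates, and elimination of a state -/

section Rates

variable {S : Type*}

/-- `μ` is a stationary distribution, on the finite set `A`, of the Markov process that jumps from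
`x` to `y` at the rate `q x y`. The diagonal rates cancel. -/
structure IsStationaryOn (A : Finset S) (q : S → S → ℝ) (μ : S → ℝ) : Prop where
  nonneg : ∀ x ∈ A, 0 ≤ μ x
  sum_eq_one : ∑ x ∈ A, μ x = 1
  balance : ∀ y ∈ A, ∑ x ∈ A, μ x * q x y = μ y * ∑ z ∈ A, q y z

theorem IsStationaryOn.le_one {A : Finset S} {q : S → S → ℝ} {μ : S → ℝ}
    (h : IsStationaryOn A q μ) {x : S} (hx : x ∈ A) : μ x ≤ 1 :=
  h.sum_eq_one ▸ Finset.single_le_sum h.nonneg hx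

variable [DecidableEq S]

/-- The rate at which the process on `A` leaves the state `u`. -/
def exitRate (A : Finset S) (q : S → S → ℝ) (u : S) : ℝ := ∑ z ∈ A.erase u, q u z

/-- The rates, up to the factor `exitRate A q u`, of the process watched outside of `u`. -/
def eliminate (A : Finset S) (q : S → S → ℝ) (u : S) : S → S → ℝ := fun x y =>
  exitRate A q u * q x y + q x u * q u y

theorem exitRate_nonneg {A : Finset S} {q : S → S → ℝ} (hq : ∀ x y, 0 ≤ q x y) (u : S) :
    0 ≤ exitRate A q u := Finset.sum_nonneg fun _ _ => hq _ _

theorem eliminate_nonneg {A : Finset S} {q : S → S → ℝ} (hq : ∀ x y, 0 ≤ q x y) (u x y : S) :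
    0 ≤ eliminate A q u x y :=
  add_nonneg (mul_nonneg (exitRate_nonneg hq u) (hq _ _)) (mul_nonneg (hq _ _) (hq _ _))

theorem le_exitRate {A : Finset S} {q : S → S → ℝ} (hq : ∀ x y, 0 ≤ q x y) {u v : S}
    (hv : v ∈ A) (huv : u ≠ v) : q u v ≤ exitRate A q u :=
  Finset.single_le_sum (f := fun z => q u z) (fun _ _ => hq _ _) (Finset.mem_erase.2 ⟨huv.symm, hv⟩)

theorem sum_mul_eliminate (A : Finset S) (q : S → S → ℝ) (μ : S → ℝ) (u y : S) :
    ∑ x ∈ A.erase u, μ x * eliminate A q u x y =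
      exitRate A q u * ∑ x ∈ A.erase u, μ x * q x y +
        q u y * ∑ x ∈ A.erase u, μ x * q x u := by
  rw [Finset.mul_sum, Finset.mul_sum, ← Finset.sum_add_distrib]
  exact Finset.sum_congr rfl fun x _ => by rw [eliminate]; ring

/-- Rerouting through `u` distributes `q y u` in proportion to the jumps out of `u`, so for `u ∈ A`
the row sum of `y` is only multiplied by the exit rate. The sum includes the return `y → u → y` on
the diagonal. -/
theorem sum_eliminate (A : Finset S) (q : S → S → ℝ) (u y : S) :
    ∑ z ∈ A.erase u, eliminate A q u y z =
      exitRate A q u * ∑ z ∈ A.erase u, q y z + q y u * exitRate A q u := by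
  simp_rw [eliminate]
  rw [Finset.sum_add_distrib, ← Finset.mul_sum, ← Finset.mul_sum, exitRate]

/-- If there are no jumps, then every Dirac mass is stationary. -/
theorem isStationaryOn_single {A : Finset S} {q : S → S → ℝ} {x : S} (hx : x ∈ A)
    (h : ∀ y ∈ A, ∀ z ∈ A, y ≠ z → q y z = 0) : IsStationaryOn A q (Pi.single x 1) where
  nonneg y _ := by
    by_cases hy : y = x
    · subst hy; simp
    · simp [hy]
  sum_eq_one := by simp [Pi.single_apply, hx]
  balance y hy := by
    have h₁ : ∑ z ∈ A, q y z = q y y :=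
      Finset.sum_eq_single_of_mem y hy fun z hz hzy => h y hy z hz hzy.symm
    have h₂ : ∑ z ∈ A, (Pi.single x (1 : ℝ) : S → ℝ) z * q z y = q x y := by
      simp [Pi.single_apply, hx]
    rw [h₁, h₂]
    by_cases hxy : y = x
    · subst hxy; simp
    · simp [hxy, h x hx y hy (Ne.symm hxy)]

namespace IsStationaryOn

variable {A : Finset S} {q : S → S → ℝ} {μ : S → ℝ}

theorem mul_exitRate (h : IsStationaryOn A q μ) {u : S} (hu : u ∈ A) :
    μ u * exitRate A q u = ∑ x ∈ A.erase u, μ x * q x u := by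
  have := h.balance u hu
  rw [← Finset.add_sum_erase A _ hu, ← Finset.add_sum_erase A _ hu] at this
  rw [exitRate]
  linarith

/-- Restricting a stationary distribution to the complement of a state. -/
theorem restrict (h : IsStationaryOn A q μ) {u : S} (hu : u ∈ A) (h1 : μ u < 1) :
    IsStationaryOn (A.erase u) (eliminate A q u) fun x => μ x / (1 - μ u) where
  nonneg x hx := div_nonneg (h.nonneg x (Finset.mem_of_mem_erase hx)) (by linarith)
  sum_eq_one := by
    have := h.sum_eq_one
    rw [← Finset.add_sum_erase A _ hu] at this
    rw [← Finset.sum_div, div_eq_one_iff_eq (by linarith)]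
    linarith
  balance y hy := by
    have hyA := Finset.mem_of_mem_erase hy
    have b := h.balance y hyA
    rw [← Finset.add_sum_erase A _ hu, ← Finset.add_sum_erase A _ hu] at b
    have e := h.mul_exitRate hu
    simp_rw [div_mul_eq_mul_div]
    rw [← Finset.sum_div, sum_mul_eliminate, sum_eliminate, ← e]
    congr 1
    -- The balance at `y`, multiplied by the exit rate; `e` has already replaced the inflow of `u`.
    -- Nothing is divided by the exit rate, so it may vanish.
    linear_combination exitRate A q u * b

/-- Extending a stationary distribution on the complement of a state. -/
theorem extend {u : S} (h : IsStationaryOn (A.erase u) (eliminate A q u) μ) (hu : u ∈ A)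
    (hq : ∀ x y, 0 ≤ q x y) (hσ : 0 < exitRate A q u) {t : ℝ}
    (ht : t = (∑ x ∈ A.erase u, μ x * q x u) / exitRate A q u) :
    IsStationaryOn A q fun x => (if x = u then t else μ x) / (1 + t) := by
  have ht0 : 0 ≤ t := ht ▸ div_nonneg
    (Finset.sum_nonneg fun x hx => mul_nonneg (h.nonneg x hx) (hq _ _)) hσ.le
  have e : t * exitRate A q u = ∑ x ∈ A.erase u, μ x * q x u := by
    rw [ht, div_mul_cancel₀ _ hσ.ne']
  have off : ∀ f : S → ℝ, ∑ x ∈ A.erase u, (if x = u then t else μ x) * f x =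
      ∑ x ∈ A.erase u, μ x * f x := fun f =>
    Finset.sum_congr rfl fun x hx => by rw [if_neg (Finset.ne_of_mem_erase hx)]
  refine ⟨fun x hx => div_nonneg ?_ (by linarith), ?_, fun y hy => ?_⟩
  · split_ifs with hxu
    · exact ht0
    · exact h.nonneg x (Finset.mem_erase.2 ⟨hxu, hx⟩)
  · have := off fun _ => 1
    simp only [mul_one, h.sum_eq_one] at this
    rw [← Finset.sum_div, ← Finset.add_sum_erase A _ hu, this, if_pos rfl, add_comm,
      div_self (by linarith)]
  · simp_rw [div_mul_eq_mul_div]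
    rw [← Finset.sum_div, ← Finset.add_sum_erase A _ hu, off, if_pos rfl,
      ← Finset.add_sum_erase A _ hu]
    congr 1
    by_cases hyu : y = u
    · subst hyu
      rw [if_pos rfl, ← e, exitRate]
      ring
    · rw [if_neg hyu]
      have b := h.balance y (Finset.mem_erase.2 ⟨hyu, hy⟩)
      rw [sum_mul_eliminate, sum_eliminate, ← e] at b
      -- The balance on the complement is the wanted one multiplied by the exit rate, which can be
      -- cancelled here.
      refine mul_left_cancel₀ hσ.ne' ?_
      linear_combination b

/-- In equilibrium the flow into a set of states equals the flow out of it. -/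
theorem flow_eq (h : IsStationaryOn A q μ) {D : Finset S} (hD : D ⊆ A) :
    ∑ a ∈ A \ D, ∑ b ∈ D, μ a * q a b = ∑ a ∈ D, ∑ b ∈ A \ D, μ a * q a b := by
  -- Summing the balance equations over `D` counts the flow inside `D` once on either side, where it
  -- cancels.
  have key : ∑ b ∈ D, ∑ a ∈ A, μ a * q a b = ∑ b ∈ D, ∑ z ∈ A, μ b * q b z :=
    Finset.sum_congr rfl fun b hb => by rw [h.balance b (hD hb), Finset.mul_sum]
  simp_rw [← Finset.sum_sdiff hD, Finset.sum_add_distrib] at key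
  rw [Finset.sum_comm (s := D) (t := A \ D) (f := fun b a => μ a * q a b),
    Finset.sum_comm (s := D) (t := D) (f := fun b a => μ a * q a b)] at key
  linarith

end IsStationaryOn

/-- Induction by elimination: a state with positive exit rate can be removed and its weight restored
by `IsStationaryOn.extend`. If no such state exists, nothing moves and any Dirac mass will do. -/
theorem exists_isStationaryOn {A : Finset S} (hA : A.Nonempty) {q : S → S → ℝ}
    (hq : ∀ x y, 0 ≤ q x y) : ∃ μ, IsStationaryOn A q μ := by
  induction hk : A.card generalizing A q with
  | zero => simp [Finset.card_eq_zero.1 hk] at hA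
  | succ k ih =>
    by_cases hex : ∃ u ∈ A, 0 < exitRate A q u
    · obtain ⟨u, hu, hσ⟩ := hex
      have hne : (A.erase u).Nonempty := by
        by_contra hne
        rw [Finset.not_nonempty_iff_eq_empty] at hne
        simp [exitRate, hne] at hσ
      obtain ⟨μ, hμ⟩ := ih hne (eliminate_nonneg hq u)
        (by rw [Finset.card_erase_of_mem hu, hk]; rfl)
      exact ⟨_, hμ.extend hu hq hσ rfl⟩
    · push Not at hex
      obtain ⟨x, hx⟩ := hA
      refine ⟨_, isStationaryOn_single hx fun y hy z hz hyz => le_antisymm ?_ (hq _ _)⟩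
      exact (le_exitRate hq hz hyz).trans (hex y hy)

end Rates

/-! ### Stability under elimination -/

section Stability

variable {ι S : Type*} [DecidableEq S] {l : Filter ι}

/-- The state `x` keeps a positive weight in stationary distributions along `l`. -/
def StableOn (l : Filter ι) (A : Finset S) (Q : ι → S → S → ℝ) (x : S) : Prop :=
  ∃ c > 0, ∀ᶠ ε in l, ∃ μ, IsStationaryOn A (Q ε) μ ∧ c ≤ μ x

/-- The jump from `u` to `v` is a fastest one. -/
structure IsPivot (l : Filter ι) (A : Finset S) (Q : ι → S → S → ℝ) (u v : S) : Prop where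
  left_mem : u ∈ A
  right_mem : v ∈ A
  ne : u ≠ v
  isBigO : ∀ x ∈ A, ∀ y ∈ A, x ≠ y → (fun ε => Q ε x y) =O[l] fun ε => Q ε u v

/-- Any two rates are comparable. -/
def ComparableOn (l : Filter ι) (A : Finset S) (Q : ι → S → S → ℝ) : Prop :=
  ∀ x ∈ A, ∀ y ∈ A, x ≠ y → ∀ x' ∈ A, ∀ y' ∈ A, x' ≠ y' →
    (fun ε => Q ε x y) =O[l] (fun ε => Q ε x' y') ∨ (fun ε => Q ε x' y') =O[l] fun ε => Q ε x y

variable {A : Finset S} {Q : ι → S → S → ℝ} {u v : S}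

theorem isBigO_iff_eventually_le_of_nonneg {f g : ι → ℝ} (hf : ∀ ε, 0 ≤ f ε)
    (hg : ∀ ε, 0 ≤ g ε) : f =O[l] g ↔ ∃ K > 0, ∀ᶠ ε in l, f ε ≤ K * g ε := by
  rw [isBigO_iff']
  simp only [Real.norm_of_nonneg (hf _), Real.norm_of_nonneg (hg _)]

/-- There are finitely many pairs, so the sum of their constants serves all of them at once. -/
theorem IsPivot.exists_bound (h : IsPivot l A Q u v) (hQ : ∀ ε x y, 0 ≤ Q ε x y) :
    ∃ K > 0, ∀ᶠ ε in l, ∀ x ∈ A, ∀ y ∈ A, x ≠ y → Q ε x y ≤ K * Q ε u v := by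
  have : ∀ x y, ∃ K > 0, ∀ᶠ ε in l, x ∈ A → y ∈ A → x ≠ y → Q ε x y ≤ K * Q ε u v := by
    intro x y
    by_cases hxy : x ∈ A ∧ y ∈ A ∧ x ≠ y
    · obtain ⟨K, hK, hb⟩ := (isBigO_iff_eventually_le_of_nonneg (fun ε => hQ ε x y)
        (fun ε => hQ ε u v)).1 (h.isBigO x hxy.1 y hxy.2.1 hxy.2.2)
      exact ⟨K, hK, hb.mono fun ε hε _ _ _ => hε⟩
    · exact ⟨1, one_pos, Eventually.of_forall fun ε h₁ h₂ h₃ => absurd ⟨h₁, h₂, h₃⟩ hxy⟩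
  choose K hK hb using this
  refine ⟨∑ x ∈ A, ∑ y ∈ A, K x y, Finset.sum_pos (fun x _ => Finset.sum_pos
    (fun y _ => hK x y) ⟨u, h.left_mem⟩) ⟨u, h.left_mem⟩, ?_⟩
  have ev : ∀ᶠ ε in l, ∀ x ∈ A, ∀ y ∈ A, x ∈ A → y ∈ A → x ≠ y → Q ε x y ≤ K x y * Q ε u v := by
    simp_rw [Filter.eventually_all_finset]
    exact fun x _ y _ => hb x y
  refine ev.mono fun ε hε x hx y hy hxy => (hε x hx y hy hx hy hxy).trans
    (mul_le_mul_of_nonneg_right ?_ (hQ ε u v))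
  calc K x y ≤ ∑ y ∈ A, K x y := Finset.single_le_sum (fun y _ => (hK x y).le) hy
    _ ≤ _ := Finset.single_le_sum (f := fun x => ∑ y ∈ A, K x y)
      (fun x _ => Finset.sum_nonneg fun y _ => (hK x y).le) hx

theorem exitRate_le {q : S → S → ℝ} {b : ℝ} (hb : ∀ z ∈ A, u ≠ z → q u z ≤ b) (h0 : 0 ≤ b) :
    exitRate A q u ≤ A.card * b := by
  calc exitRate A q u ≤ (A.erase u).card • b := Finset.sum_le_card_nsmul _ _ _ fun z hz =>
        hb z (Finset.mem_of_mem_erase hz) (Finset.ne_of_mem_erase hz).symm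
    _ ≤ A.card * b := by
      rw [nsmul_eq_mul]
      exact mul_le_mul_of_nonneg_right (by exact_mod_cast Finset.card_le_card (A.erase_subset u)) h0

/-- This lets the program use the pivot rate in place of the exit rate, which is a sum and hence not
available to it. -/
theorem IsPivot.exitRate_isTheta (h : IsPivot l A Q u v) (hQ : ∀ ε x y, 0 ≤ Q ε x y) :
    (fun ε => exitRate A (Q ε) u) =Θ[l] fun ε => Q ε u v := by
  have hσ : ∀ ε, 0 ≤ exitRate A (Q ε) u := fun ε => exitRate_nonneg (hQ ε) u
  constructor
  · obtain ⟨K, hK, hb⟩ := h.exists_bound hQ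
    have hA : (0 : ℝ) < A.card := by exact_mod_cast Finset.card_pos.2 ⟨u, h.left_mem⟩
    refine (isBigO_iff_eventually_le_of_nonneg hσ fun ε => hQ ε u v).2
      ⟨A.card * K, mul_pos hA hK, hb.mono fun ε hε => ?_⟩
    rw [mul_assoc]
    exact exitRate_le (fun z hz huz => hε u h.left_mem z hz huz) (mul_nonneg hK.le (hQ ε u v))
  · refine (isBigO_iff_eventually_le_of_nonneg (fun ε => hQ ε u v) hσ).2
      ⟨1, one_pos, Eventually.of_forall fun ε => ?_⟩
    rw [one_mul]
    exact le_exitRate (hQ ε) h.right_mem h.ne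

/-- Eliminating the source of a fastest jump does not affect the stability of other states. -/
theorem IsPivot.stableOn_eliminate_iff (h : IsPivot l A Q u v) (hQ : ∀ ε x y, 0 ≤ Q ε x y)
    {x : S} (hx : x ∈ A.erase u) :
    StableOn l (A.erase u) (fun ε => eliminate A (Q ε) u) x ↔ StableOn l A Q x := by
  obtain ⟨K, hK, hb⟩ := h.exists_bound hQ
  have hxA := Finset.mem_of_mem_erase hx
  have hxu := Finset.ne_of_mem_erase hx
  constructor
  · rintro ⟨c, hc, hs⟩
    -- Extension divides by `1 + t`, where the weight `t` given to `u` is at most `K`. The `1`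
    -- covers the parameters at which the pivot rate vanishes: then all rates between distinct
    -- states vanish and the Dirac mass at `x` is stationary.
    refine ⟨min 1 (c / (1 + K)), lt_min one_pos (by positivity), ?_⟩
    filter_upwards [hb, hs] with ε bε ⟨μ, hμ, hcμ⟩
    rcases (hQ ε u v).eq_or_lt with h0 | h0
    · refine ⟨_, isStationaryOn_single hxA fun y hy z hz hyz => le_antisymm ?_ (hQ _ _ _), ?_⟩
      · simpa [← h0] using bε y hy z hz hyz
      · simp
    · have hσ : 0 < exitRate A (Q ε) u := h0.trans_le (le_exitRate (hQ ε) h.right_mem h.ne)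
      refine ⟨_, hμ.extend h.left_mem (hQ ε) hσ rfl, (min_le_right _ _).trans ?_⟩
      rw [if_neg hxu]
      have s0 : 0 ≤ ∑ x ∈ A.erase u, μ x * Q ε x u :=
        Finset.sum_nonneg fun y hy => mul_nonneg (hμ.nonneg y hy) (hQ _ _ _)
      have s1 : ∑ x ∈ A.erase u, μ x * Q ε x u ≤ K * Q ε u v := by
        calc ∑ x ∈ A.erase u, μ x * Q ε x u ≤ ∑ x ∈ A.erase u, μ x * (K * Q ε u v) :=
              Finset.sum_le_sum fun y hy => mul_le_mul_of_nonneg_left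
                (bε y (Finset.mem_of_mem_erase hy) u h.left_mem (Finset.ne_of_mem_erase hy))
                (hμ.nonneg y hy)
          _ = K * Q ε u v := by rw [← Finset.sum_mul, hμ.sum_eq_one, one_mul]
      have s2 : (∑ x ∈ A.erase u, μ x * Q ε x u) / exitRate A (Q ε) u ≤ K := by
        rw [div_le_iff₀ hσ]
        exact s1.trans (mul_le_mul_of_nonneg_left (le_exitRate (hQ ε) h.right_mem h.ne) hK.le)
      have s3 := div_nonneg s0 hσ.le
      exact div_le_div₀ (hc.le.trans hcμ) hcμ (by linarith) (by linarith)
  · rintro ⟨c, hc, hs⟩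
    refine ⟨min 1 c, lt_min one_pos hc, ?_⟩
    filter_upwards [hb, hs] with ε bε ⟨μ, hμ, hcμ⟩
    have hu0 := hμ.nonneg u h.left_mem
    have hu1 : μ x + μ u ≤ 1 := by
      rw [← hμ.sum_eq_one, ← Finset.add_sum_erase A _ h.left_mem, add_comm]
      exact add_le_add_right (Finset.single_le_sum
        (fun y hy => hμ.nonneg y (Finset.mem_of_mem_erase hy)) hx) _
    rcases (hQ ε u v).eq_or_lt with h0 | h0
    · have z : ∀ y ∈ A, ∀ z ∈ A, y ≠ z → Q ε y z = 0 := fun y hy z hz hyz =>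
        le_antisymm (by simpa [← h0] using bε y hy z hz hyz) (hQ _ _ _)
      have hσ : exitRate A (Q ε) u = 0 := Finset.sum_eq_zero fun y hy =>
        z u h.left_mem y (Finset.mem_of_mem_erase hy) (Finset.ne_of_mem_erase hy).symm
      refine ⟨_, isStationaryOn_single hx fun y hy w hw hyw => ?_, ?_⟩
      · rw [eliminate, hσ, z u h.left_mem w (Finset.mem_of_mem_erase hw)
          (Finset.ne_of_mem_erase hw).symm]
        simp
      · simp
    -- Restriction divides by `1 - μ u ≤ 1` and can only increase the weight of `x`; `1 - μ u` is
    -- positive because `x` has weight at least `c`.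
    · refine ⟨_, hμ.restrict h.left_mem (by linarith), (min_le_right _ _).trans ?_⟩
      rw [le_div_iff₀ (by linarith)]
      nlinarith

/-- Stability passes along fastest jumps. -/
theorem IsPivot.stableOn_of_isBigO (h : IsPivot l A Q u v) (hQ : ∀ ε x y, 0 ≤ Q ε x y)
    {x y : S} (hx : x ∈ A) (hy : y ∈ A) (hxy : x ≠ y)
    (hO : (fun ε => Q ε u v) =O[l] fun ε => Q ε x y) (hs : StableOn l A Q x) :
    StableOn l A Q y := by
  obtain ⟨K, hK, hb⟩ := h.exists_bound hQ
  obtain ⟨K', hK', hb'⟩ := (isBigO_iff_eventually_le_of_nonneg (fun ε => hQ ε u v)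
    fun ε => hQ ε x y).1 hO
  obtain ⟨c, hc, hs⟩ := hs
  have hA : (0 : ℝ) < A.card := by exact_mod_cast Finset.card_pos.2 ⟨u, h.left_mem⟩
  -- The inflow of `y` is at least `c * Q ε x y`, hence at least `c / K'` times the pivot rate. Its
  -- outflow is at most `μ y` times `A.card * K` times the pivot rate.
  refine ⟨min 1 (c / (K' * (A.card * K))), lt_min one_pos (by positivity), ?_⟩
  filter_upwards [hb, hb', hs] with ε bε bε' ⟨μ, hμ, hcμ⟩
  rcases (hQ ε u v).eq_or_lt with h0 | h0
  · refine ⟨_, isStationaryOn_single hy fun y hy z hz hyz => le_antisymm ?_ (hQ _ _ _), ?_⟩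
    · simpa [← h0] using bε y hy z hz hyz
    · simp
  · refine ⟨μ, hμ, (min_le_right _ _).trans ?_⟩
    have e := hμ.mul_exitRate hy
    have e1 : exitRate A (Q ε) y ≤ A.card * (K * Q ε u v) :=
      exitRate_le (fun z hz huz => bε y hy z hz huz) (mul_nonneg hK.le (hQ ε u v))
    have e2 : μ x * Q ε x y ≤ ∑ x ∈ A.erase y, μ x * Q ε x y :=
      Finset.single_le_sum (f := fun x => μ x * Q ε x y) (fun z hz => mul_nonneg
        (hμ.nonneg z (Finset.mem_of_mem_erase hz)) (hQ _ _ _)) (Finset.mem_erase.2 ⟨hxy, hx⟩)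
    have e3 : c * Q ε x y ≤ μ y * (A.card * (K * Q ε u v)) :=
      calc c * Q ε x y ≤ μ x * Q ε x y := mul_le_mul_of_nonneg_right hcμ (hQ _ _ _)
        _ ≤ μ y * exitRate A (Q ε) y := e ▸ e2
        _ ≤ _ := mul_le_mul_of_nonneg_left e1 (hμ.nonneg y hy)
    rw [div_le_iff₀ (by positivity)]
    refine le_of_mul_le_mul_right ?_ h0
    calc c * Q ε u v ≤ c * (K' * Q ε x y) := mul_le_mul_of_nonneg_left bε' hc.le
      _ = K' * (c * Q ε x y) := by ring
      _ ≤ K' * (μ y * (A.card * (K * Q ε u v))) := mul_le_mul_of_nonneg_left e3 hK'.le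
      _ = μ y * (K' * (A.card * K)) * Q ε u v := by ring

/-- A finite family of pairwise comparable functions has a dominating member. -/
theorem exists_forall_isBigO {κ : Type*} {s : Finset κ} (hs : s.Nonempty) (f : κ → ι → ℝ)
    (ht : ∀ a ∈ s, ∀ b ∈ s, f a =O[l] f b ∨ f b =O[l] f a) :
    ∃ a ∈ s, ∀ b ∈ s, f b =O[l] f a := by
  induction hs using Finset.Nonempty.cons_induction with
  | singleton a => exact ⟨a, by simp, fun b hb => by
      rw [Finset.mem_singleton.1 hb]⟩
  | cons a s ha hs ih =>
    obtain ⟨b, hb, hmax⟩ := ih fun x hx y hy =>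
      ht x (Finset.mem_cons_of_mem hx) y (Finset.mem_cons_of_mem hy)
    rcases ht a (Finset.mem_cons_self a s) b (Finset.mem_cons_of_mem hb) with hab | hab
    · refine ⟨b, Finset.mem_cons_of_mem hb, fun x hx => ?_⟩
      rcases Finset.mem_cons.1 hx with rfl | hx
      exacts [hab, hmax x hx]
    · refine ⟨a, Finset.mem_cons_self a s, fun x hx => ?_⟩
      rcases Finset.mem_cons.1 hx with rfl | hx
      exacts [isBigO_refl _ _, (hmax x hx).trans hab]

/-- The source of a fastest jump is stable if and only if it is the target of a fastest jump from
a stable state. -/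
theorem IsPivot.stableOn_left_iff (h : IsPivot l A Q u v) (hQ : ∀ ε x y, 0 ≤ Q ε x y)
    (hc : ComparableOn l A Q) :
    StableOn l A Q u ↔
      ∃ x ∈ A.erase u, StableOn l A Q x ∧ (fun ε => Q ε u v) =O[l] fun ε => Q ε x u := by
  classical
  constructor
  · intro hs
    -- The graph of the jumps of maximal order. Stability propagates along it from `u` to `v` and
    -- onwards; if it leads back to `u`, the last state before `u` is the witness.
    let E : S → S → Prop := fun x y => x ∈ A ∧ y ∈ A ∧ x ≠ y ∧
      (fun ε => Q ε u v) =O[l] fun ε => Q ε x y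
    have prop : ∀ y, Relation.ReflTransGen E v y → StableOn l A Q y := by
      intro y hy
      induction hy with
      | refl => exact h.stableOn_of_isBigO hQ h.left_mem h.right_mem h.ne (isBigO_refl _ _) hs
      | tail _ e ih => exact h.stableOn_of_isBigO hQ e.1 e.2.1 e.2.2.1 e.2.2.2 ih
    by_cases hu : Relation.ReflTransGen E v u
    · rcases Relation.ReflTransGen.cases_tail hu with huv | ⟨x, hvx, hxu⟩
      · exact absurd huv h.ne
      · exact ⟨x, Finset.mem_erase.2 ⟨hxu.2.2.1, hxu.1⟩, prop x hvx, hxu.2.2.2⟩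
    · exfalso
      let D := A.filter (Relation.ReflTransGen E v)
      have hDA : D ⊆ A := Finset.filter_subset _ _
      have hv : v ∈ D := Finset.mem_filter.2 ⟨h.right_mem, .refl⟩
      have huD : u ∈ A \ D := Finset.mem_sdiff.2
        ⟨h.left_mem, fun hD => hu (Finset.mem_filter.1 hD).2⟩
      have hne : (D ×ˢ (A \ D)).Nonempty := ⟨(v, u), Finset.mem_product.2 ⟨hv, huD⟩⟩
      have pr : ∀ e ∈ D ×ˢ (A \ D), e.1 ∈ A ∧ e.2 ∈ A ∧ e.1 ≠ e.2 := by
        intro e he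
        rw [Finset.mem_product, Finset.mem_sdiff] at he
        exact ⟨hDA he.1, he.2.1, fun hh => he.2.2 (hh ▸ he.1)⟩
      obtain ⟨⟨a, b⟩, hab, hmax⟩ := exists_forall_isBigO hne (fun e ε => Q ε e.1 e.2) (l := l)
        fun e he e' he' => hc _ (pr e he).1 _ (pr e he).2.1 (pr e he).2.2
          _ (pr e' he').1 _ (pr e' he').2.1 (pr e' he').2.2
      -- By comparability a single jump `a → b` out of `D` dominates all of them. Stability of `u`
      -- and equality of flows make it maximal, so `b` would be reachable from `v` and lie in `D`.
      have hsum : (fun ε => ∑ e ∈ D ×ˢ (A \ D), Q ε e.1 e.2) =O[l] fun ε => Q ε a b :=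
        IsBigO.fun_sum hmax
      have hτ : (fun ε => Q ε u v) =O[l] fun ε => ∑ e ∈ D ×ˢ (A \ D), Q ε e.1 e.2 := by
        obtain ⟨c, hc0, hs⟩ := hs
        refine (isBigO_iff_eventually_le_of_nonneg (fun ε => hQ ε u v)
          fun ε => Finset.sum_nonneg fun _ _ => hQ _ _ _).2 ⟨c⁻¹, inv_pos.2 hc0, ?_⟩
        filter_upwards [hs] with ε ⟨μ, hμ, hcμ⟩
        have flow := hμ.flow_eq hDA
        have nn : ∀ a ∈ A, ∀ b, 0 ≤ μ a * Q ε a b := fun a ha b =>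
          mul_nonneg (hμ.nonneg a ha) (hQ _ _ _)
        have f1 : μ u * Q ε u v ≤ ∑ a ∈ A \ D, ∑ b ∈ D, μ a * Q ε a b := by
          calc μ u * Q ε u v ≤ ∑ b ∈ D, μ u * Q ε u b :=
                Finset.single_le_sum (f := fun b => μ u * Q ε u b)
                  (fun b _ => nn u h.left_mem b) hv
            _ ≤ _ := Finset.single_le_sum (f := fun a => ∑ b ∈ D, μ a * Q ε a b)
                (fun a ha => Finset.sum_nonneg fun b _ => nn a (Finset.mem_sdiff.1 ha).1 b) huD
        have f2 : ∑ a ∈ D, ∑ b ∈ A \ D, μ a * Q ε a b ≤ ∑ e ∈ D ×ˢ (A \ D), Q ε e.1 e.2 := by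
          rw [Finset.sum_product]
          exact Finset.sum_le_sum fun a ha => Finset.sum_le_sum fun b _ =>
            mul_le_of_le_one_left (hQ _ _ _) (hμ.le_one (hDA ha))
        rw [inv_mul_eq_div, le_div_iff₀ hc0, mul_comm]
        exact (mul_le_mul_of_nonneg_right hcμ (hQ _ _ _)).trans (f1.trans (flow ▸ f2))
      have hp := pr _ hab
      rw [Finset.mem_product, Finset.mem_sdiff] at hab
      exact hab.2.2 (Finset.mem_filter.2 ⟨hp.2.1, (Finset.mem_filter.1 hab.1).2.tail
        ⟨hp.1, hp.2.1, hp.2.2, hτ.trans hsum⟩⟩)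
  · rintro ⟨x, hx, hs, hO⟩
    exact h.stableOn_of_isBigO hQ (Finset.mem_of_mem_erase hx) h.left_mem
      (Finset.ne_of_mem_erase hx) hO hs

theorem stableOn_singleton (x : S) : StableOn l {x} Q x := by
  refine ⟨1, one_pos, Eventually.of_forall fun ε =>
    ⟨_, isStationaryOn_single (Finset.mem_singleton_self x) fun y hy z hz hyz => ?_, ?_⟩⟩
  · exact absurd ((Finset.mem_singleton.1 hy).trans (Finset.mem_singleton.1 hz).symm) hyz
  · simp

/-- A sum of nonnegative functions has the order of the dominating one. -/
theorem isTheta_add_of_isBigO {f g f' g' : ι → ℝ} (hf : ∀ ε, 0 ≤ f ε) (hg : ∀ ε, 0 ≤ g ε)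
    (hff : f =Θ[l] f') (hgg : g =Θ[l] g') (h : f' =O[l] g') : (fun ε => f ε + g ε) =Θ[l] g' := by
  refine ⟨(hff.1.trans h).add hgg.1, hgg.2.trans ?_⟩
  exact (isBigO_iff_eventually_le_of_nonneg hg fun ε => add_nonneg (hf ε) (hg ε)).2
    ⟨1, one_pos, Eventually.of_forall fun ε => by linarith [hf ε]⟩

end Stability

theorem ComparableOn.exists_isPivot {ι S : Type*} {l : Filter ι} {A : Finset S}
    {Q : ι → S → S → ℝ} (hc : ComparableOn l A Q) (hA : A.Nontrivial) :
    ∃ u v, IsPivot l A Q u v := by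
  obtain ⟨a, ha, b, hb, hab⟩ := hA
  have hne : A.offDiag.Nonempty := ⟨(a, b), Finset.mem_offDiag.2 ⟨ha, hb, hab⟩⟩
  obtain ⟨⟨u, v⟩, huv, hmax⟩ := exists_forall_isBigO hne (fun e ε => Q ε e.1 e.2) (l := l)
    fun e he e' he' => by
      rw [Finset.mem_offDiag] at he he'
      exact hc _ he.1 _ he.2.1 he.2.2 _ he'.1 _ he'.2.1 he'.2.2
  rw [Finset.mem_offDiag] at huv
  exact ⟨u, v, huv.1, huv.2.1, huv.2.2, fun x hx y hy hxy =>
    hmax (x, y) (Finset.mem_offDiag.2 ⟨hx, hy, hxy⟩)⟩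

/-! ### Total correctness and running time of programs -/

namespace Machine

variable {W : Type*} [LE W] [Zero W] [One W] [Mul W] [Div W]

/-- The command `c`, started in `m`, halts within `T` steps in a memory that satisfies `R`. -/
def Runs (c : Cmd) (m : Memory W) (T : ℕ) (R : Memory W → Prop) : Prop :=
  ∃ t m', Exec c m t m' ∧ t ≤ T ∧ R m'

variable {c c₁ c₂ : Cmd} {b : Test} {m : Memory W} {T T' T₁ T₂ : ℕ} {R R' : Memory W → Prop}

theorem Runs.mono (h : Runs c m T R) (hT : T ≤ T') (hR : ∀ m', R m' → R' m') : Runs c m T' R' :=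
  let ⟨t, m', e, ht, hr⟩ := h
  ⟨t, m', e, ht.trans hT, hR m' hr⟩

theorem Runs.skip (h : R m) : Runs .skip m 1 R := ⟨1, m, .skip m, le_rfl, h⟩

theorem Runs.set {x : ℕ} {e : NatExp} (h : R (m.set x (e.eval m))) : Runs (.set x e) m 1 R :=
  ⟨1, _, .set m x e, le_rfl, h⟩

theorem Runs.store {a : ℕ} {i e : NatExp} (h : R (m.store a (i.eval m) (e.eval m))) :
    Runs (.store a i e) m 1 R := ⟨1, _, .store m a i e, le_rfl, h⟩

theorem Runs.wset {d : Cell} {v : WExp} {w : W} (hv : v.Eval m w)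
    (h : R (m.wset d.a (d.row.eval m) (d.col.eval m) w)) : Runs (.wset d v) m 1 R :=
  ⟨1, _, .wset d hv, le_rfl, h⟩

theorem Runs.seq (h : Runs c₁ m T₁ fun m' => Runs c₂ m' T₂ R) :
    Runs (.seq c₁ c₂) m (T₁ + T₂) R :=
  let ⟨_, _, e₁, ht₁, _, _, e₂, ht₂, hr⟩ := h
  ⟨_, _, .seq e₁ e₂, add_le_add ht₁ ht₂, hr⟩

theorem Runs.ite (h₁ : b.Holds m → Runs c₁ m T R) (h₂ : ¬ b.Holds m → Runs c₂ m T R) :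
    Runs (.ite b c₁ c₂) m (T + 1) R := by
  by_cases hb : b.Holds m
  · obtain ⟨t, m', e, ht, hr⟩ := h₁ hb
    exact ⟨_, m', .ite_true hb e, Nat.succ_le_succ ht, hr⟩
  · obtain ⟨t, m', e, ht, hr⟩ := h₂ hb
    exact ⟨_, m', .ite_false hb e, Nat.succ_le_succ ht, hr⟩

/-- A loop whose invariant `Inv k` counts the remaining rounds. -/
theorem Runs.while (Inv : ℕ → Memory W → Prop) (exit : ∀ m, Inv 0 m → ¬ b.Holds m)
    (step : ∀ k m, Inv (k + 1) m → b.Holds m ∧ Runs c m T (Inv k)) (k : ℕ) :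
    ∀ m, Inv k m → Runs (.while b c) m (k * (T + 1) + 1) (Inv 0) := by
  induction k with
  | zero => exact fun m h => ⟨1, m, .while_false (exit m h), by simp, h⟩
  | succ k ih =>
    intro m h
    obtain ⟨hb, t, m', e, ht, h'⟩ := step k m h
    obtain ⟨t', m'', e', ht', h''⟩ := ih m' h'
    exact ⟨_, m'', .while_true hb e e', by rw [Nat.succ_mul]; omega, h''⟩

/-- Run `c` with the variable `i` counting from `0` up to the input size. -/
def Cmd.for (i : ℕ) (c : Cmd) : Cmd :=
  .seq (.set i (.lit 0))
    (.while (.lt (.var i) (.var 0)) (.seq c (.set i (.succ (.var i)))))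

/-- A round costs the body, the increment and one test; the remaining `2` are the initialisation and
the last, failing test. The invariant must ignore the counter, as the increment follows the body. -/
theorem Runs.for {i n : ℕ} (Inv : ℕ → Memory W → Prop) (size : ∀ k m, Inv k m → m.var 0 = n)
    (indep : ∀ k m v, Inv k m → Inv k (m.set i v))
    (step : ∀ k < n, ∀ m, m.var i = k → Inv k m →
      Runs c m T fun m' => m'.var i = k ∧ Inv (k + 1) m') (h : Inv 0 m) :
    Runs (.for i c) m (n * (T + 2) + 2) (Inv n) := by
  have hset : ∀ (m : Memory W) v, (m.set i v).var i = v := fun m v => by simp [Memory.set]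
  refine (Runs.seq (T₁ := 1) (T₂ := n * (T + 1 + 1) + 1) (R := Inv n) (.set ?_)).mono
    (by ring_nf; rfl) fun _ h => h
  refine (Runs.while (T := T + 1)
    -- `Runs.while` counts the remaining rounds, the given invariant the completed ones; `r ≤ n`
    -- keeps the subtraction honest.
    (fun r m => r ≤ n ∧ m.var i = n - r ∧ Inv (n - r) m) ?_ ?_ n _ ?_).mono le_rfl
    fun m h => h.2.2
  · rintro m ⟨-, hi, hm⟩
    simp [Test.Holds, NatExp.eval, hi, size _ _ hm]
  · rintro r m ⟨hr, hi, hm⟩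
    refine ⟨?_, .seq ((step _ (by omega) m hi hm).mono le_rfl fun m' h' => .set ?_)⟩
    · simp only [Test.Holds, NatExp.eval, hi, size _ _ hm]
      omega
    · have e : n - (r + 1) + 1 = n - r := by omega
      simp only [NatExp.eval, h'.1, e, hset]
      exact ⟨by omega, trivial, indep _ _ _ (e ▸ h'.2)⟩
  · simp only [NatExp.eval, hset, Nat.sub_self]
    exact ⟨le_rfl, trivial, indep _ _ _ h⟩

/-- A double loop over all pairs of indices. -/
theorem Runs.for_for {i j n : ℕ} (hij : i ≠ j) (Inv : ℕ → ℕ → Memory W → Prop)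
    (size : ∀ k k' m, Inv k k' m → m.var 0 = n)
    (indep₁ : ∀ k k' m v, Inv k k' m → Inv k k' (m.set i v))
    (indep₂ : ∀ k k' m v, Inv k k' m → Inv k k' (m.set j v))
    (row : ∀ k m, Inv k n m → Inv (k + 1) 0 m)
    (step : ∀ k < n, ∀ k' < n, ∀ m, m.var i = k → m.var j = k' → Inv k k' m →
      Runs c m T fun m' => m'.var i = k ∧ m'.var j = k' ∧ Inv k (k' + 1) m') (h : Inv 0 0 m) :
    Runs (.for i (.for j c)) m (n * (n * (T + 2) + 4) + 2) (Inv n 0) := by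
  refine Runs.for (fun k m => Inv k 0 m) (fun k => size k 0) (fun k => indep₁ k 0) ?_ h
  intro k hk m hi hm
  refine (Runs.for (fun k' m => m.var i = k ∧ Inv k k' m) (fun k' m h => size k k' m h.2)
    ?_ ?_ ⟨hi, hm⟩).mono le_rfl fun m' h' => ⟨h'.1, row k m' h'.2⟩
  · rintro k' m v ⟨h₁, h₂⟩
    exact ⟨by simpa [Memory.set, hij] using h₁, indep₂ _ _ _ _ h₂⟩
  · rintro k' hk' m hj ⟨h₁, h₂⟩
    exact (step k hk k' hk' m h₁ hj h₂).mono le_rfl fun m' h' => ⟨h'.2.1, h'.1, h'.2.2⟩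

end Machine

/-! ### The program

Variable `1` holds the number of states that are left, variables `2` and `3` the current pivot, and
variables `4` and `5` are loop counters. Array `0` holds the marks, array `1` tells which states have
been eliminated, and arrays `2` and `3` record the pivots. The rates are in matrix `0`; matrix `1`
is used for intermediate results. -/

namespace Machine

/-- The state `e` has not been eliminated. -/
def Test.alive (e : NatExp) : Test := .eq (.arr 1 e) (.lit 0)

/-- The distinct states in the loop counters have not been eliminated. -/
def Test.alivePair : Test :=
  .and (.alive (.var 4)) (.and (.alive (.var 5)) (.not (.eq (.var 4) (.var 5))))

/-- Find a largest rate between distinct states that are left. -/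
def searchPivot : Cmd :=
  .seq (.wset ⟨1, .lit 0, .lit 0⟩ .zero)
    (.for 4 (.for 5 (.ite (.and .alivePair (.wle ⟨1, .lit 0, .lit 0⟩ ⟨0, .var 4, .var 5⟩))
      (.seq (.wset ⟨1, .lit 0, .lit 0⟩ (.get ⟨0, .var 4, .var 5⟩))
        (.seq (.set 2 (.var 4)) (.set 3 (.var 5))))
      .skip)))

/-- Record the pivot and eliminate its source. -/
def recordPivot : Cmd :=
  .seq (.set 1 (.pred (.var 1))) (.seq (.store 2 (.var 1) (.var 2))
    (.seq (.store 3 (.var 1) (.var 3)) (.store 1 (.var 2) (.lit 1))))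

/-- Compute the rates between the states that are left. -/
def updateRates : Cmd :=
  .for 4 (.for 5 (.ite .alivePair
    (.seq (.wset ⟨1, .lit 0, .lit 1⟩ (.mul ⟨0, .var 2, .var 3⟩ ⟨0, .var 4, .var 5⟩))
      (.seq (.wset ⟨1, .lit 0, .lit 2⟩ (.mul ⟨0, .var 4, .var 2⟩ ⟨0, .var 2, .var 5⟩))
        (.ite (.wle ⟨1, .lit 0, .lit 1⟩ ⟨1, .lit 0, .lit 2⟩)
          (.wset ⟨0, .var 4, .var 5⟩ (.get ⟨1, .lit 0, .lit 2⟩))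
          (.wset ⟨0, .var 4, .var 5⟩ (.get ⟨1, .lit 0, .lit 1⟩)))))
    .skip))

/-- Mark the states that are left. -/
def markAlive : Cmd := .for 4 (.ite (.alive (.var 4)) (.store 0 (.var 4) (.lit 1)) .skip)

/-- Mark the source of the pivot if some marked state jumps to it as fast. -/
def markPivot : Cmd :=
  .for 4 (.ite
    (.and (.eq (.arr 0 (.var 4)) (.lit 1)) (.wle ⟨0, .var 2, .var 3⟩ ⟨0, .var 4, .var 2⟩))
    (.store 0 (.var 2) (.lit 1)) .skip)

/-- Eliminate all states but one. -/
def eliminateStates : Cmd :=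
  .seq (.set 1 (.var 0)) (.while (.lt (.lit 1) (.var 1))
    (.seq searchPivot (.seq recordPivot updateRates)))

/-- Mark the eliminated states, in reverse order. -/
def markEliminated : Cmd :=
  .while (.lt (.var 1) (.var 0)) (.seq (.set 2 (.arr 2 (.var 1)))
    (.seq (.set 3 (.arr 3 (.var 1))) (.seq markPivot (.set 1 (.succ (.var 1))))))

/-- Mark the stable states. -/
def markStable : Cmd := .seq eliminateStates (.seq markAlive markEliminated)

/-! ### Correctness of the parts of the program -/

/-- The states that are left. -/
def aliveStates (n : ℕ) (a : ℕ → ℕ) : Finset ℕ := (Finset.range n).filter fun x => a x = 0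

theorem mem_aliveStates {n x : ℕ} {a : ℕ → ℕ} : x ∈ aliveStates n a ↔ x < n ∧ a x = 0 := by
  simp [aliveStates]

/-- The double loop over pairs below `n` has dealt with `(x, y)` when its counters are `k, k'`. -/
def Visited (n k k' x y : ℕ) : Prop := y < n ∧ (x < k ∨ x = k ∧ y < k')

theorem not_visited_zero {n x y : ℕ} : ¬ Visited n 0 0 x y := by
  unfold Visited; omega

theorem Visited.row {n k x y : ℕ} : Visited n (k + 1) 0 x y ↔ Visited n k n x y := by
  unfold Visited; omega

theorem Visited.succ {n k k' x y : ℕ} (hk' : k' < n) :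
    Visited n k (k' + 1) x y ↔ Visited n k k' x y ∨ x = k ∧ y = k' := by
  unfold Visited; omega

theorem not_visited_self {n k k' : ℕ} : ¬ Visited n k k' k k' := by
  unfold Visited; omega

theorem visited_all {n x y : ℕ} (hx : x < n) (hy : y < n) : Visited n n 0 x y := by
  unfold Visited; omega

open Classical in
/-- The entry of the rate matrix `w` at `(x, y)` after the elimination of `u` by the pivot
`(u, v)`. -/
noncomputable def eliminateEntry {W : Type*} [LE W] [Mul W] (w : ℕ → ℕ → W) (u v x y : ℕ) : W :=
  if w u v * w x y ≤ w x u * w u y then w x u * w u y else w u v * w x y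

variable {W : Type*} [LE W] [Zero W] [One W] [Mul W] [Div W] {m : Memory W} {n : ℕ}

/-- The best value so far starts as the class `0`, and the test that replaces it is not strict. The
first admissible pair is therefore always accepted, and a pivot is found even if all rates are of
class `0`. -/
theorem runs_searchPivot (hn : m.var 0 = n) {A : Finset ℕ} (hA : A = aliveStates n (m.arr 1))
    (hA2 : A.Nontrivial) (trans : ∀ a b c : W, a ≤ b → b ≤ c → a ≤ c)
    (zero_le : ∀ x ∈ A, ∀ y ∈ A, x ≠ y → 0 ≤ m.mat 0 x y)
    (total : ∀ x ∈ A, ∀ y ∈ A, x ≠ y → ∀ x' ∈ A, ∀ y' ∈ A, x' ≠ y' →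
      m.mat 0 x y ≤ m.mat 0 x' y' ∨ m.mat 0 x' y' ≤ m.mat 0 x y) :
    Runs searchPivot m (n * (n * 6 + 4) + 3) fun m' =>
      m'.var 0 = n ∧ m'.var 1 = m.var 1 ∧ m'.arr = m.arr ∧ m'.mat 0 = m.mat 0 ∧
      m'.var 2 ∈ A ∧ m'.var 3 ∈ A ∧ m'.var 2 ≠ m'.var 3 ∧
      ∀ x ∈ A, ∀ y ∈ A, x ≠ y → m.mat 0 x y ≤ m.mat 0 (m'.var 2) (m'.var 3) := by
  have refl : ∀ x ∈ A, ∀ y ∈ A, x ≠ y → m.mat 0 x y ≤ m.mat 0 x y := fun x hx y hy hxy =>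
    or_self_iff.1 (total x hx y hy hxy x hx y hy hxy)
  refine (Runs.seq (T₁ := 1) (T₂ := n * (n * 6 + 4) + 2) (.wset .zero ?_)).mono
    (by omega) fun _ h => h
  refine (Runs.for_for (T := 4) (n := n) (by decide) (fun k k' m' =>
    m'.var 0 = n ∧ m'.var 1 = m.var 1 ∧ m'.arr = m.arr ∧ m'.mat 0 = m.mat 0 ∧
    ((∀ x ∈ A, ∀ y ∈ A, x ≠ y → ¬ Visited n k k' x y) ∧ m'.mat 1 0 0 = 0 ∨
      (m'.var 2 ∈ A ∧ m'.var 3 ∈ A ∧ m'.var 2 ≠ m'.var 3) ∧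
      m'.mat 1 0 0 = m.mat 0 (m'.var 2) (m'.var 3) ∧
      ∀ x ∈ A, ∀ y ∈ A, x ≠ y → Visited n k k' x y →
        m.mat 0 x y ≤ m.mat 0 (m'.var 2) (m'.var 3)))
    ?_ ?_ ?_ ?_ ?_ ?_).mono le_rfl ?_
  · exact fun _ _ _ h => h.1
  · exact fun _ _ _ _ h => by simpa [Memory.set] using h
  · exact fun _ _ _ _ h => by simpa [Memory.set] using h
  · exact fun _ _ h => by simpa only [Visited.row] using h
  · rintro k hk k' hk' m' rfl rfl ⟨h0, h1, ha, hm, hbest⟩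
    have hpair : Test.alivePair.Holds m' ↔
        m'.var 4 ∈ A ∧ m'.var 5 ∈ A ∧ m'.var 4 ≠ m'.var 5 := by
      simp [Test.alivePair, Test.alive, Test.Holds, NatExp.eval, hA, mem_aliveStates, hk, hk', ha]
    refine Runs.ite (T := 3) ?_ ?_
    · rintro ⟨hp, hle⟩
      obtain ⟨hx, hy, hxy⟩ := hpair.1 hp
      simp only [Test.Holds, Cell.eval, NatExp.eval, hm] at hle
      refine Runs.seq (T₁ := 1) (T₂ := 2) (.wset (.get _) (.seq (T₁ := 1) (T₂ := 1)
        (.set (.set ?_))))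
      simp only [Visited.succ hk', Memory.set, Memory.wset, Cell.eval, NatExp.eval, hm, ha]
      refine ⟨by simp, by simp, by simpa using h0, by simpa using h1, trivial, by simp [hm], .inr
        ⟨by simpa using ⟨hx, hy, hxy⟩, by simp, fun x hx' y hy' hxy' hv => ?_⟩⟩
      suffices m.mat 0 x y ≤ m.mat 0 (m'.var 4) (m'.var 5) by simpa using this
      rcases hv with hv | ⟨rfl, rfl⟩
      · rcases hbest with ⟨hb, -⟩ | ⟨-, hb, hall⟩
        · exact absurd hv (hb x hx' y hy' hxy')
        · exact trans _ _ _ (hall x hx' y hy' hxy' hv) (hb ▸ hle)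
      · exact refl _ hx' _ hy' hxy'
    · intro hneg
      refine (Runs.skip ?_).mono (by omega) fun _ h => h
      refine ⟨rfl, rfl, h0, h1, ha, hm, ?_⟩
      have hneg' : m'.var 4 ∈ A → m'.var 5 ∈ A → m'.var 4 ≠ m'.var 5 →
          ¬ m'.mat 1 0 0 ≤ m.mat 0 (m'.var 4) (m'.var 5) := fun hx hy hxy hle =>
        hneg ⟨hpair.2 ⟨hx, hy, hxy⟩, by simpa [Test.Holds, Cell.eval, NatExp.eval, hm] using hle⟩
      simp only [Visited.succ hk']
      rcases hbest with ⟨hb, h00⟩ | ⟨hp, hb, hall⟩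
      · refine .inl ⟨fun x hx y hy hxy hv => ?_, h00⟩
        rcases hv with hv | ⟨rfl, rfl⟩
        · exact hb x hx y hy hxy hv
        · exact hneg' hx hy hxy (h00 ▸ zero_le _ hx _ hy hxy)
      · refine .inr ⟨hp, hb, fun x hx y hy hxy hv => ?_⟩
        rcases hv with hv | ⟨rfl, rfl⟩
        · exact hall x hx y hy hxy hv
        · rcases total _ hx _ hy hxy _ hp.1 _ hp.2.1 hp.2.2 with h | h
          · exact h
          · exact absurd (hb ▸ h) (hneg' hx hy hxy)
  · simp only [Memory.wset, NatExp.eval]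
    refine ⟨hn, trivial, trivial, by simp, .inl ⟨fun _ _ _ _ _ => not_visited_zero, by simp⟩⟩
  · rintro m' ⟨h0, h1, ha, hm, hbest⟩
    have lt : ∀ x ∈ A, x < n := fun x hx => (mem_aliveStates.1 (hA ▸ hx)).1
    rcases hbest with ⟨hb, -⟩ | ⟨hp, -, hall⟩
    · obtain ⟨x, hx, y, hy, hxy⟩ := hA2
      exact absurd (visited_all (lt x hx) (lt y hy)) (hb x hx y hy hxy)
    · exact ⟨h0, h1, ha, hm, hp.1, hp.2.1, hp.2.2, fun x hx y hy hxy =>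
        hall x hx y hy hxy (visited_all (lt x hx) (lt y hy))⟩

-- Updating in place is harmless: the new entry at `(x, y)` depends on the old entry there and on
-- row and column `u`, and these are never written because `u ∉ A`.
open Classical in
theorem runs_updateRates (hn : m.var 0 = n) {A : Finset ℕ} (hA : A = aliveStates n (m.arr 1))
    {u v : ℕ} (hu : m.var 2 = u) (hv : m.var 3 = v) (huA : u ∉ A) :
    Runs updateRates m (n * (n * 7 + 4) + 2) fun m' =>
      m'.var 0 = n ∧ m'.var 1 = m.var 1 ∧ m'.arr = m.arr ∧ ∀ x y, m'.mat 0 x y =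
        if x ∈ A ∧ y ∈ A ∧ x ≠ y then eliminateEntry (m.mat 0) u v x y else m.mat 0 x y := by
  refine (Runs.for_for (T := 5) (n := n) (by decide) (fun k k' m' =>
    m'.var 0 = n ∧ m'.var 1 = m.var 1 ∧ m'.var 2 = u ∧ m'.var 3 = v ∧ m'.arr = m.arr ∧
    ∀ x y, m'.mat 0 x y = if (x ∈ A ∧ y ∈ A ∧ x ≠ y) ∧ Visited n k k' x y
      then eliminateEntry (m.mat 0) u v x y else m.mat 0 x y)
    ?_ ?_ ?_ ?_ ?_ ?_).mono le_rfl ?_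
  · exact fun _ _ _ h => h.1
  · exact fun _ _ _ _ h => by simpa [Memory.set] using h
  · exact fun _ _ _ _ h => by simpa [Memory.set] using h
  · exact fun _ _ h => by simpa only [Visited.row] using h
  · rintro k hk k' hk' m' rfl rfl ⟨h0, h1, h2, h3, ha, hm⟩
    have hpair : Test.alivePair.Holds m' ↔
        m'.var 4 ∈ A ∧ m'.var 5 ∈ A ∧ m'.var 4 ≠ m'.var 5 := by
      simp [Test.alivePair, Test.alive, Test.Holds, NatExp.eval, hA, mem_aliveStates, hk, hk', ha]
    refine Runs.ite (T := 4) ?_ ?_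
    · intro hp
      have hp' := hpair.1 hp
      have e1 : m'.mat 0 u v = m.mat 0 u v := by rw [hm, if_neg fun h => huA h.1.1]
      have e2 : m'.mat 0 (m'.var 4) (m'.var 5) = m.mat 0 (m'.var 4) (m'.var 5) := by
        rw [hm, if_neg fun h => not_visited_self h.2]
      have e3 : m'.mat 0 (m'.var 4) u = m.mat 0 (m'.var 4) u := by
        rw [hm, if_neg fun h => huA h.1.2.1]
      have e4 : m'.mat 0 u (m'.var 5) = m.mat 0 u (m'.var 5) := by
        rw [hm, if_neg fun h => huA h.1.1]
      have key : ∀ w : ℕ → ℕ → W,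
          w = Function.update (m'.mat 0) (m'.var 4) (Function.update (m'.mat 0 (m'.var 4))
            (m'.var 5) (eliminateEntry (m.mat 0) u v (m'.var 4) (m'.var 5))) →
          ∀ x y, w x y = if (x ∈ A ∧ y ∈ A ∧ x ≠ y) ∧ Visited n (m'.var 4) (m'.var 5 + 1) x y
            then eliminateEntry (m.mat 0) u v x y else m.mat 0 x y := by
        rintro w rfl x y
        simp only [Visited.succ hk']
        by_cases hx : x = m'.var 4
        · by_cases hy : y = m'.var 5
          · rw [if_pos (by subst hx hy; exact ⟨hp', .inr ⟨rfl, rfl⟩⟩), hx, hy]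
            simp
          · rw [hx, Function.update_self, Function.update_of_ne hy, hm]
            simp [hy]
        · rw [Function.update_of_ne hx, hm]
          simp [hx]
      refine Runs.seq (T₁ := 1) (T₂ := 3) (.wset (.mul _ _) (.seq (T₁ := 1) (T₂ := 2)
        (.wset (.mul _ _) (.ite (T := 1) (fun hle => .wset (.get _) ?_)
          fun hle => .wset (.get _) ?_))))
      all_goals
        simp [Test.Holds, Memory.wset, Cell.eval, NatExp.eval, h2, h3, e1, e2, e3, e4] at hle ⊢
        refine ⟨h0, h1, ha, key _ ?_⟩
        simp [eliminateEntry, hle]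
    · intro hp
      refine (Runs.skip ?_).mono (by omega) fun _ h => h
      refine ⟨rfl, rfl, h0, h1, h2, h3, ha, fun x y => ?_⟩
      rw [hm]
      refine if_congr (and_congr_right fun hxy => ?_) rfl rfl
      rw [Visited.succ hk', iff_self_or]
      rintro ⟨rfl, rfl⟩
      exact absurd (hpair.2 hxy) hp
  · exact ⟨hn, rfl, hu, hv, rfl, fun x y => by rw [if_neg fun h => not_visited_zero h.2]⟩
  · rintro m' ⟨h0, h1, -, -, ha, hm⟩
    refine ⟨h0, h1, ha, fun x y => ?_⟩
    rw [hm]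
    refine if_congr (and_iff_left_of_imp fun h => ?_) rfl rfl
    rw [hA, mem_aliveStates, mem_aliveStates] at h
    exact visited_all h.1.1 h.2.1.1

theorem runs_markAlive (hn : m.var 0 = n) (h0 : ∀ x, m.arr 0 x = 0) :
    Runs markAlive m (n * 4 + 2) fun m' =>
      m'.var 0 = n ∧ m'.var 1 = m.var 1 ∧ (∀ a ≠ 0, m'.arr a = m.arr a) ∧ m'.mat = m.mat ∧
      ∀ x, m'.arr 0 x = 1 ↔ x ∈ aliveStates n (m.arr 1) := by
  refine (Runs.for (T := 2) (n := n) (fun k m' =>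
    m'.var 0 = n ∧ m'.var 1 = m.var 1 ∧ (∀ a ≠ 0, m'.arr a = m.arr a) ∧ m'.mat = m.mat ∧
      ∀ x, m'.arr 0 x = 1 ↔ x ∈ aliveStates k (m.arr 1)) ?_ ?_ ?_ ?_).mono le_rfl fun _ h => h
  · exact fun _ _ h => h.1
  · exact fun _ _ _ h => by simpa [Memory.set] using h
  · rintro k hk m' rfl ⟨hv0, hv1, ha, hm, hx⟩
    have e : ∀ x, x ∈ aliveStates (m'.var 4 + 1) (m.arr 1) ↔
        x ∈ aliveStates (m'.var 4) (m.arr 1) ∨ x = m'.var 4 ∧ m.arr 1 (m'.var 4) = 0 := by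
      intro x
      simp only [mem_aliveStates]
      constructor
      · rintro ⟨h, h'⟩
        rcases Nat.lt_succ_iff_lt_or_eq.1 h with h | rfl
        exacts [.inl ⟨h, h'⟩, .inr ⟨rfl, h'⟩]
      · rintro (⟨h, h'⟩ | ⟨rfl, h'⟩)
        exacts [⟨by omega, h'⟩, ⟨by omega, h'⟩]
    refine Runs.ite (T := 1) (fun h => .store ?_) fun h => .skip ?_
    · simp [Test.alive, Test.Holds, NatExp.eval, ha] at h
      refine ⟨rfl, hv0, hv1, fun a ha0 => by simp [Memory.store, ha0, ha], hm, fun x => ?_⟩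
      rw [e, ← hx]
      by_cases hxk : x = m'.var 4 <;> simp [Memory.store, NatExp.eval, hxk, h]
    · simp [Test.alive, Test.Holds, NatExp.eval, ha] at h
      exact ⟨rfl, hv0, hv1, ha, hm, fun x => by rw [e, ← hx]; simp [h]⟩
  · exact ⟨hn, rfl, fun _ _ => rfl, rfl, fun x => by simp [h0, mem_aliveStates]⟩

theorem runs_markPivot (hn : m.var 0 = n) {u v : ℕ} (hu : m.var 2 = u) (hv : m.var 3 = v) :
    Runs markPivot m (n * 4 + 2) fun m' =>
      m'.var 0 = n ∧ m'.var 1 = m.var 1 ∧ (∀ a ≠ 0, m'.arr a = m.arr a) ∧ m'.mat = m.mat ∧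
      ∀ x, m'.arr 0 x = 1 ↔
        m.arr 0 x = 1 ∨ x = u ∧ ∃ y < n, m.arr 0 y = 1 ∧ m.mat 0 u v ≤ m.mat 0 y u := by
  refine (Runs.for (T := 2) (n := n) (fun k m' =>
    m'.var 0 = n ∧ m'.var 1 = m.var 1 ∧ m'.var 2 = u ∧ m'.var 3 = v ∧
      (∀ a ≠ 0, m'.arr a = m.arr a) ∧ m'.mat = m.mat ∧ ∀ x, m'.arr 0 x = 1 ↔
        m.arr 0 x = 1 ∨ x = u ∧ ∃ y < k, m.arr 0 y = 1 ∧ m.mat 0 u v ≤ m.mat 0 y u)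
    ?_ ?_ ?_ ?_).mono le_rfl fun _ h => ⟨h.1, h.2.1, h.2.2.2.2⟩
  · exact fun _ _ h => h.1
  · exact fun _ _ _ h => by simpa [Memory.set] using h
  · rintro k hk m' rfl ⟨hv0, hv1, hv2, hv3, ha, hm, hx⟩
    refine Runs.ite (T := 1) (fun h => .store ?_) fun h => .skip ?_
    · simp only [Test.Holds, NatExp.eval, Cell.eval, hv2, hv3, hm] at h
      refine ⟨rfl, hv0, hv1, hv2, hv3, fun a ha0 => by simp [Memory.store, ha0, ha], hm,
        fun x => ?_⟩
      by_cases hxu : x = u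
      · subst hxu
        have : (m'.store 0 ((NatExp.var 2).eval m') ((NatExp.lit 1).eval m')).arr 0 x = 1 := by
          simp [Memory.store, NatExp.eval, hv2]
        simp only [this, true_and, true_iff]
        -- The marked state just met may be `u` itself, marked earlier in this loop; then the
        -- witness from that earlier round is used.
        rcases (hx _).1 h.1 with h4 | ⟨h4, y, hy, hy'⟩
        · exact .inr ⟨_, Nat.lt_succ_self _, h4, h.2⟩
        · exact .inr ⟨y, by omega, hy'⟩
      · have : (m'.store 0 ((NatExp.var 2).eval m') ((NatExp.lit 1).eval m')).arr 0 x =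
            m'.arr 0 x := by
          simp [Memory.store, NatExp.eval, hv2, hxu]
        rw [this, hx]
        simp [hxu]
    · simp only [Test.Holds, NatExp.eval, Cell.eval, hv2, hv3, hm] at h
      refine ⟨rfl, hv0, hv1, hv2, hv3, ha, hm, fun x => ?_⟩
      rw [hx]
      refine or_congr_right (and_congr_right fun _ => ⟨?_, ?_⟩)
      · rintro ⟨y, hy, hy'⟩
        exact ⟨y, by omega, hy'⟩
      · rintro ⟨y, hy, h1, h2⟩
        rcases Nat.lt_succ_iff_lt_or_eq.1 hy with hy | rfl
        · exact ⟨y, hy, h1, h2⟩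
        · exact absurd ⟨(hx _).2 (.inl h1), h2⟩ h
  · exact ⟨hn, rfl, hu, hv, fun _ _ => rfl, rfl, fun x => by simp⟩

end Machine

/-! ### Rates up to mutual domination -/

section Represents

variable {I : Set ℝ} {M : Subsemigroup (I → unitInterval)} {A : Finset ℕ}
  {Q : I → ℕ → ℕ → ℝ} {w : ℕ → ℕ → AsympClass I}

/-- The matrix `w` consists, off the diagonal, of the classes of the rates `Q`, and these are the
classes of members of `M`. -/
def Represents (M : Subsemigroup (I → unitInterval)) (A : Finset ℕ) (Q : I → ℕ → ℕ → ℝ)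
    (w : ℕ → ℕ → AsympClass I) : Prop :=
  ∀ x ∈ A, ∀ y ∈ A, x ≠ y → ∃ f ∈ M, w x y = AsympClass.mk f ∧
    (fun ε => Q ε x y) =Θ[towardsZero I] fun ε => (f ε : ℝ)

theorem AsympClass.le_trans (a b c : AsympClass I) (hab : a ≤ b) (hbc : b ≤ c) : a ≤ c := by
  induction a using Quotient.ind
  induction b using Quotient.ind
  induction c using Quotient.ind
  exact Dominated.trans hab hbc

theorem AsympClass.zero_le (a : AsympClass I) : 0 ≤ a := by
  induction a using Quotient.ind with
  | _ f =>
    change (fun _ => (0 : ℝ)) =O[towardsZero I] fun ε => (f ε : ℝ)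
    exact isBigO_zero _ _

theorem Represents.le_iff (h : Represents M A Q w) {x y x' y' : ℕ} (hx : x ∈ A) (hy : y ∈ A)
    (hxy : x ≠ y) (hx' : x' ∈ A) (hy' : y' ∈ A) (hxy' : x' ≠ y') :
    w x y ≤ w x' y' ↔ (fun ε => Q ε x y) =O[towardsZero I] fun ε => Q ε x' y' := by
  obtain ⟨f, -, hw, hf⟩ := h x hx y hy hxy
  obtain ⟨g, -, hw', hg⟩ := h x' hx' y' hy' hxy'
  rw [hw, hw', hf.isBigO_congr_left, hg.isBigO_congr_right]
  exact Iff.rfl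

theorem Represents.comparableOn (h : Represents M A Q w)
    (hM : ∀ f ∈ M, ∀ g ∈ M, Dominated f g ∨ Dominated g f) :
    ComparableOn (towardsZero I) A Q := by
  intro x hx y hy hxy x' hx' y' hy' hxy'
  obtain ⟨f, hfM, -, hf⟩ := h x hx y hy hxy
  obtain ⟨g, hgM, -, hg⟩ := h x' hx' y' hy' hxy'
  rw [hf.isBigO_congr_left, hg.isBigO_congr_right, hg.isBigO_congr_left, hf.isBigO_congr_right]
  exact hM f hfM g hgM

/-- Both terms of the new rate are nonnegative, with orders given by products in `M`; comparability
in `M` says which one determines the order of the sum, and the entry selects it. Since `x`, `y` and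
`u` are distinct, no diagonal entry is read. -/
theorem Represents.eliminate (h : Represents M A Q w) (hQ : ∀ ε x y, 0 ≤ Q ε x y)
    (hM : ∀ f ∈ M, ∀ g ∈ M, Dominated f g ∨ Dominated g f) {u v : ℕ}
    (hp : IsPivot (towardsZero I) A Q u v) :
    Represents M (A.erase u) (fun ε => eliminate A (Q ε) u) (Machine.eliminateEntry w u v) := by
  intro x hx y hy hxy
  obtain ⟨hxu, hxA⟩ := Finset.mem_erase.1 hx
  obtain ⟨hyu, hyA⟩ := Finset.mem_erase.1 hy
  obtain ⟨τ, hτM, hwτ, hτ⟩ := h u hp.left_mem v hp.right_mem hp.ne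
  obtain ⟨f, hfM, hwf, hf⟩ := h x hxA y hyA hxy
  obtain ⟨g, hgM, hwg, hg⟩ := h x hxA u hp.left_mem hxu
  obtain ⟨k, hkM, hwk, hk⟩ := h u hp.left_mem y hyA hyu.symm
  have h₁ : (fun ε => exitRate A (Q ε) u * Q ε x y) =Θ[towardsZero I]
      fun ε => ((τ * f) ε : ℝ) := ((hp.exitRate_isTheta hQ).trans hτ).mul hf
  have h₂ : (fun ε => Q ε x u * Q ε u y) =Θ[towardsZero I] fun ε => ((g * k) ε : ℝ) := hg.mul hk
  have n₁ : ∀ ε, 0 ≤ exitRate A (Q ε) u * Q ε x y := fun ε =>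
    mul_nonneg (exitRate_nonneg (hQ ε) u) (hQ _ _ _)
  have n₂ : ∀ ε, 0 ≤ Q ε x u * Q ε u y := fun ε => mul_nonneg (hQ _ _ _) (hQ _ _ _)
  have e : Machine.eliminateEntry w u v x y =
      open Classical in if Dominated (τ * f) (g * k) then AsympClass.mk (g * k)
        else AsympClass.mk (τ * f) := by
    rw [Machine.eliminateEntry, hwτ, hwf, hwg, hwk]
    rfl
  rw [e]
  split_ifs with hd
  · exact ⟨g * k, M.mul_mem hgM hkM, rfl, isTheta_add_of_isBigO n₁ n₂ h₁ h₂ hd⟩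
  · refine ⟨τ * f, M.mul_mem hτM hfM, rfl, ?_⟩
    simp only [_root_.eliminate, add_comm (exitRate _ _ _ * _)]
    exact isTheta_add_of_isBigO n₂ n₁ h₂ h₁
      ((hM _ (M.mul_mem hτM hfM) _ (M.mul_mem hgM hkM)).resolve_left hd)

/-- Eliminate pivots until one state is left; its stability lifts back through every elimination. -/
theorem Represents.exists_stableOn (h : Represents M A Q w) (hQ : ∀ ε x y, 0 ≤ Q ε x y)
    (hM : ∀ f ∈ M, ∀ g ∈ M, Dominated f g ∨ Dominated g f) (hA : A.Nonempty) :
    ∃ x ∈ A, StableOn (towardsZero I) A Q x := by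
  induction hk : A.card generalizing A Q w with
  | zero => simp [Finset.card_eq_zero.1 hk] at hA
  | succ k ih =>
    obtain ⟨a, rfl⟩ | hA2 := hA.exists_eq_singleton_or_nontrivial
    · exact ⟨a, Finset.mem_singleton_self a, stableOn_singleton a⟩
    · obtain ⟨u, v, hp⟩ := (h.comparableOn hM).exists_isPivot hA2
      obtain ⟨x, hx, hs⟩ := ih (h.eliminate hQ hM hp) (fun ε => eliminate_nonneg (hQ ε) u)
        ⟨v, Finset.mem_erase.2 ⟨hp.ne.symm, hp.right_mem⟩⟩
        (by rw [Finset.card_erase_of_mem hp.left_mem, hk]; rfl)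
      exact ⟨x, Finset.mem_of_mem_erase hx, (hp.stableOn_eliminate_iff hQ hx).1 hs⟩

end Represents

/-! ### Correctness of the program -/

namespace Machine

variable {I : Set ℝ} {M : Subsemigroup (I → unitInterval)} {n k : ℕ} {St : ℕ → Prop}
  {m : Memory (AsympClass I)}

/-- The states that are left when `k` states are left, and those recorded at positions from `k`
up to `j`. -/
def Known (n : ℕ) (m : Memory (AsympClass I)) (k j x : ℕ) : Prop :=
  x ∈ aliveStates n (m.arr 1) ∨ ∃ i, k ≤ i ∧ i < j ∧ m.arr 2 i = x

/-- The invariant of the elimination phase, with `k` states left: the rates in matrix `0` have the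
same stable states, and every recorded state can be decided from those eliminated later. -/
structure Eliminating (M : Subsemigroup (I → unitInterval)) (n : ℕ) (St : ℕ → Prop) (k : ℕ)
    (m : Memory (AsympClass I)) : Prop where
  size : m.var 0 = n
  left : m.var 1 = k
  card : (aliveStates n (m.arr 1)).card = k
  unmarked : ∀ x, m.arr 0 x = 0
  rates : ∃ Q : I → ℕ → ℕ → ℝ, (∀ ε x y, 0 ≤ Q ε x y) ∧
    Represents M (aliveStates n (m.arr 1)) Q (m.mat 0) ∧
    ∀ x ∈ aliveStates n (m.arr 1),
      StableOn (towardsZero I) (aliveStates n (m.arr 1)) Q x ↔ St x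
  dead : ∀ j, k ≤ j → j < n → m.arr 2 j ∉ aliveStates n (m.arr 1)
  complete : ∀ x < n, Known n m k n x
  pivots : ∀ j, k ≤ j → j < n → (St (m.arr 2 j) ↔ ∃ x, Known n m k j x ∧ St x ∧
    m.mat 0 (m.arr 2 j) (m.arr 3 j) ≤ m.mat 0 x (m.arr 2 j))

theorem aliveStates_update {n u : ℕ} {a : ℕ → ℕ} :
    aliveStates n (Function.update a u 1) = (aliveStates n a).erase u := by
  ext x
  by_cases hx : x = u <;> simp [mem_aliveStates, hx]

/-- An update writes only between states that are left. The entries that decide a recorded pivot lie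
in the row or column of its eliminated source, so they stay frozen and remain available for the
marking phase. Records are stored at decreasing positions, and moving `u` from the states left to
position `k` does not change what is known at later positions. -/
theorem Eliminating.runs_round (hM : ∀ f ∈ M, ∀ g ∈ M, Dominated f g ∨ Dominated g f)
    (h : Eliminating M n St (k + 1) m) (hk : 1 ≤ k) :
    Runs (.seq searchPivot (.seq recordPivot updateRates)) m (n * (n * 13 + 8) + 9)
      (Eliminating M n St k) := by
  obtain ⟨Q, hQ, hR, hS⟩ := h.rates
  set A := aliveStates n (m.arr 1) with hA
  -- There are `k + 1` states left among `n`, so position `k` for the new record is below `n`.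
  have hkn : k < n := by
    have := Finset.card_filter_le (Finset.range n) fun x => m.arr 1 x = 0
    rw [← aliveStates, ← hA, h.card, Finset.card_range] at this
    omega
  refine (Runs.seq (T₁ := n * (n * 6 + 4) + 3) (T₂ := 4 + (n * (n * 7 + 4) + 2))
    ((runs_searchPivot h.size hA (Finset.one_lt_card_iff_nontrivial.1 (by rw [h.card]; omega))
      AsympClass.le_trans (fun _ _ _ _ _ => AsympClass.zero_le _) ?_).mono le_rfl ?_)).mono
    (by nlinarith) fun _ h => h
  · intro x hx y hy hxy x' hx' y' hy' hxy'
    rw [hR.le_iff hx hy hxy hx' hy' hxy', hR.le_iff hx' hy' hxy' hx hy hxy]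
    exact hR.comparableOn hM x hx y hy hxy x' hx' y' hy' hxy'
  rintro m₁ ⟨hv0, hv1, ha, hm, hu, hv, huv, hmax⟩
  have hp : IsPivot (towardsZero I) A Q (m₁.var 2) (m₁.var 3) :=
    ⟨hu, hv, huv, fun x hx y hy hxy => (hR.le_iff hx hy hxy hu hv huv).1 (hmax x hx y hy hxy)⟩
  rw [h.left] at hv1
  generalize hu2 : m₁.var 2 = u at *
  generalize hv3 : m₁.var 3 = v at *
  refine Runs.seq (T₁ := 4) (.seq (T₁ := 1) (T₂ := 3) (.set (.seq (T₁ := 1) (T₂ := 2) (.store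
    (.seq (T₁ := 1) (T₂ := 1) (.store (.store ?_)))))))
  set m₂ : Memory (AsympClass I) := _
  change Runs updateRates m₂ _ _
  have w0 : m₂.var 0 = n := by simp [m₂, Memory.set, Memory.store, hv0]
  have w1 : m₂.var 1 = k := by simp [m₂, Memory.set, Memory.store, NatExp.eval, hv1]
  have w2 : m₂.var 2 = u := by simp [m₂, Memory.set, Memory.store, hu2]
  have w3 : m₂.var 3 = v := by simp [m₂, Memory.set, Memory.store, hv3]
  have a0 : m₂.arr 0 = m.arr 0 := by simp [m₂, Memory.set, Memory.store, ha]
  have a1 : m₂.arr 1 = Function.update (m.arr 1) u 1 := by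
    simp [m₂, Memory.set, Memory.store, NatExp.eval, ha, hu2]
  have a2 : m₂.arr 2 = Function.update (m.arr 2) k u := by
    simp [m₂, Memory.set, Memory.store, NatExp.eval, ha, hu2, hv1]
  have a3 : m₂.arr 3 = Function.update (m.arr 3) k v := by
    simp [m₂, Memory.set, Memory.store, NatExp.eval, ha, hv3, hv1]
  have wm : m₂.mat 0 = m.mat 0 := by simp [m₂, Memory.set, Memory.store, hm]
  clear_value m₂
  have hB : A.erase u = aliveStates n (m₂.arr 1) := by rw [a1, aliveStates_update]
  refine (runs_updateRates w0 hB w2 w3 (Finset.notMem_erase u A)).mono le_rfl ?_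
  rintro m' ⟨z0, z1, za, zm⟩
  rw [wm] at zm
  have hB' : aliveStates n (m'.arr 1) = A.erase u := by rw [za, hB]
  have a2' : m'.arr 2 = Function.update (m.arr 2) k u := by rw [za, a2]
  have a3' : m'.arr 3 = Function.update (m.arr 3) k v := by rw [za, a3]
  have old2 : ∀ j, k + 1 ≤ j → m'.arr 2 j = m.arr 2 j := fun j hj => by
    rw [a2', Function.update_of_ne (by omega)]
  have old3 : ∀ j, k + 1 ≤ j → m'.arr 3 j = m.arr 3 j := fun j hj => by
    rw [a3', Function.update_of_ne (by omega)]
  have new2 : m'.arr 2 k = u := by rw [a2', Function.update_self]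
  have new3 : m'.arr 3 k = v := by rw [a3', Function.update_self]
  have row : ∀ x y, x ∉ A.erase u → m'.mat 0 x y = m.mat 0 x y := fun x y hx => by
    rw [zm, if_neg fun h => hx h.1]
  have col : ∀ x y, y ∉ A.erase u → m'.mat 0 x y = m.mat 0 x y := fun x y hy => by
    rw [zm, if_neg fun h => hy h.2.1]
  have known : ∀ j, k + 1 ≤ j → ∀ x, Known n m' k j x ↔ Known n m (k + 1) j x := by
    intro j hj x
    rw [Known, Known, hB', ← hA, Finset.mem_erase]
    constructor
    · rintro (⟨-, hx⟩ | ⟨i, hi, hij, rfl⟩)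
      · exact .inl hx
      · rcases hi.eq_or_lt with rfl | hi
        · exact .inl (new2 ▸ hu)
        · exact .inr ⟨i, hi, hij, (old2 i hi).symm⟩
    · rintro (hx | ⟨i, hi, hij, rfl⟩)
      · by_cases hxu : x = u
        · exact .inr ⟨k, le_rfl, hj, new2.trans hxu.symm⟩
        · exact .inl ⟨hxu, hx⟩
      · exact .inr ⟨i, by omega, hij, old2 i hi⟩
  refine ⟨z0, z1.trans w1, ?_, fun x => ?_, ⟨fun ε => eliminate A (Q ε) u,
      fun ε => eliminate_nonneg (hQ ε) u, ?_, ?_⟩,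
    fun j hkj hj => ?_, fun x hx => (known n hkn x).2 (h.complete x hx), fun j hkj hj => ?_⟩
  · rw [hB', Finset.card_erase_of_mem hu, h.card]; rfl
  · rw [za, a0, h.unmarked]
  · rw [hB']
    intro x hx y hy hxy
    rw [zm, if_pos ⟨hx, hy, hxy⟩]
    exact hR.eliminate hQ hM hp x hx y hy hxy
  · rw [hB']
    exact fun x hx => (hp.stableOn_eliminate_iff hQ hx).trans (hS x (Finset.mem_of_mem_erase hx))
  · rw [hB']
    rcases hkj.eq_or_lt with rfl | hkj
    · rw [new2]; exact Finset.notMem_erase u A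
    · rw [old2 j hkj]
      exact fun hh => h.dead j hkj hj (Finset.mem_of_mem_erase hh)
  · rcases hkj.eq_or_lt with rfl | hkj
    · rw [new2, new3, row _ _ (Finset.notMem_erase u A), ← hS u hu,
        hp.stableOn_left_iff hQ (hR.comparableOn hM)]
      refine exists_congr fun x => ?_
      -- For the record just made, the interval of earlier positions is empty: only the states left
      -- are known, which is what the stability criterion for a pivot source ranges over.
      have hx : Known n m' k k x ↔ x ∈ A.erase u := by
        rw [Known, hB', or_iff_left]
        rintro ⟨i, hi, hi', -⟩
        omega
      rw [hx]
      refine and_congr_right fun hx => ?_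
      obtain ⟨hxu, hxA⟩ := Finset.mem_erase.1 hx
      rw [hS x hxA, col _ _ (Finset.notMem_erase u A), hR.le_iff hu hv huv hxA hu hxu]
    · have hd : m.arr 2 j ∉ A.erase u := fun hh =>
        h.dead j hkj hj (Finset.mem_of_mem_erase hh)
      rw [old2 j hkj, old3 j hkj, h.pivots j hkj hj]
      refine exists_congr fun x => ?_
      rw [known j hkj, row _ _ hd, col _ _ hd]

theorem Eliminating.runs_while (hM : ∀ f ∈ M, ∀ g ∈ M, Dominated f g ∨ Dominated g f)
    (h : Eliminating M n St (k + 1) m) :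
    Runs (.while (.lt (.lit 1) (.var 1)) (.seq searchPivot (.seq recordPivot updateRates))) m
      (k * (n * (n * 13 + 8) + 9 + 1) + 1) (Eliminating M n St 1) := by
  refine Runs.while (fun r => Eliminating M n St (r + 1)) ?_ ?_ k m h
  · intro m h
    simp [Test.Holds, NatExp.eval, h.left]
  · intro r m h
    exact ⟨by simp [Test.Holds, NatExp.eval, h.left], h.runs_round hM (by omega)⟩

/-- The invariant of the marking phase: the stable ones among the known states are marked. -/
structure Marking (n : ℕ) (St : ℕ → Prop) (m₀ : Memory (AsympClass I)) (j : ℕ)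
    (m : Memory (AsympClass I)) : Prop where
  size : m.var 0 = n
  position : m.var 1 = j
  arr_eq : ∀ a ≠ 0, m.arr a = m₀.arr a
  mat_eq : m.mat = m₀.mat
  marks : ∀ x, m.arr 0 x = 1 ↔ Known n m₀ 1 j x ∧ St x

/-- The stable states known before position `j` are already marked, so the test in `markPivot` is
the criterion in `Eliminating.pivots`. The scan only sees indices below `n`, which is why `hlt` is
required. -/
theorem Marking.runs_round {m₀ : Memory (AsympClass I)} (h₀ : Eliminating M n St 1 m₀) {j : ℕ}
    (hj : 1 ≤ j) (hjn : j < n) (hlt : ∀ x, Known n m₀ 1 j x → St x → x < n)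
    (h : Marking n St m₀ j m) :
    Runs (.seq (.set 2 (.arr 2 (.var 1))) (.seq (.set 3 (.arr 3 (.var 1)))
      (.seq markPivot (.set 1 (.succ (.var 1)))))) m (n * 4 + 5) (Marking n St m₀ (j + 1)) := by
  refine (Runs.seq (T₁ := 1) (T₂ := 1 + (n * 4 + 2 + 1)) (.set (.seq (.set (.seq
    ((runs_markPivot (n := n) (u := m₀.arr 2 j) (v := m₀.arr 3 j) ?_ ?_ ?_).mono le_rfl
      ?_)))))).mono (by omega) fun _ h => h
  · simp [Memory.set, h.size]
  · simp [Memory.set, NatExp.eval, h.position, h.arr_eq]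
  · simp [Memory.set, NatExp.eval, h.position, h.arr_eq]
  rintro m' ⟨hv0, hv1, ha, hm, hmarks⟩
  simp [Memory.set, h.position] at hv1
  refine .set ⟨by simpa [Memory.set] using hv0, by simp [Memory.set, NatExp.eval, hv1],
    fun a ha0 => (ha a ha0).trans (h.arr_eq a ha0), hm.trans h.mat_eq, fun x => ?_⟩
  refine (hmarks x).trans ?_
  simp only [Memory.set, h.mat_eq, h.marks]
  have known : Known n m₀ 1 (j + 1) x ↔ Known n m₀ 1 j x ∨ x = m₀.arr 2 j := by
    simp only [Known, or_assoc]
    refine or_congr_right ⟨?_, ?_⟩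
    · rintro ⟨i, hi, hij, rfl⟩
      rcases Nat.lt_succ_iff_lt_or_eq.1 hij with hij | rfl
      exacts [.inl ⟨i, hi, hij, rfl⟩, .inr rfl]
    · rintro (⟨i, hi, hij, rfl⟩ | rfl)
      exacts [⟨i, hi, by omega, rfl⟩, ⟨j, hj, by omega, rfl⟩]
  rw [known, or_and_right]
  refine or_congr_right (and_congr_right ?_)
  rintro rfl
  rw [h₀.pivots j hj hjn]
  constructor
  · rintro ⟨y, -, ⟨hy, hs⟩, hle⟩
    exact ⟨y, hy, hs, hle⟩
  · rintro ⟨y, hy, hs, hle⟩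
    exact ⟨y, hlt y hy hs, ⟨hy, hs⟩, hle⟩

theorem Marking.runs_markEliminated {m₀ : Memory (AsympClass I)} (hn : 1 ≤ n)
    (h₀ : Eliminating M n St 1 m₀) (hlt : ∀ x, St x → x < n) (h : Marking n St m₀ 1 m) :
    Runs markEliminated m ((n - 1) * (n * 4 + 5 + 1) + 1) (Marking n St m₀ n) := by
  refine Runs.while (fun r m => r ≤ n - 1 ∧ Marking n St m₀ (n - r) m) ?_ ?_ (n - 1) m ?_
    |>.mono le_rfl fun m' h' => h'.2
  · rintro m ⟨-, h⟩
    simp [Test.Holds, NatExp.eval, h.position, h.size]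
  · rintro r m ⟨hr, h⟩
    refine ⟨?_, (h.runs_round h₀ (by omega) (by omega) fun x _ => hlt x).mono le_rfl
      fun m' h' => ⟨by omega, ?_⟩⟩
    · simp only [Test.Holds, NatExp.eval, h.position, h.size]
      omega
    · rwa [show n - (r + 1) + 1 = n - r by omega] at h'
  · exact ⟨le_rfl, by rwa [show n - (n - 1) = 1 by omega]⟩

theorem runs_markStable (hM : ∀ f ∈ M, ∀ g ∈ M, Dominated f g ∨ Dominated g f) (hn : 1 ≤ n)
    (hlt : ∀ x, St x → x < n) (h : Eliminating M n St n (m.set 1 n)) (hm : m.var 0 = n) :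
    Runs markStable m (50 * n ^ 3) fun m' => ∀ x < n, m'.arr 0 x = 1 ↔ St x := by
  obtain ⟨k, rfl⟩ : ∃ k, n = k + 1 := ⟨n - 1, by omega⟩
  refine (Runs.seq (.seq (.set ?_))).mono (T := 1 + (k * ((k + 1) * ((k + 1) * 13 + 8) + 9 + 1) + 1)
    + (((k + 1) * 4 + 2) + (k * ((k + 1) * 4 + 5 + 1) + 1))) ?_ fun _ h => h
  · simp only [NatExp.eval, hm]
    refine (h.runs_while hM).mono le_rfl fun m₁ h₁ => ?_
    refine .seq ((runs_markAlive h₁.size h₁.unmarked).mono le_rfl ?_)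
    rintro m₂ ⟨hv0, hv1, ha, hmat, hx⟩
    have h₂ : Marking (k + 1) St m₁ 1 m₂ := by
      refine ⟨hv0, hv1.trans h₁.left, ha, hmat, fun x => ?_⟩
      obtain ⟨Q, -, -, hS⟩ := h₁.rates
      obtain ⟨a, hA⟩ := Finset.card_eq_one.1 h₁.card
      have : Known (k + 1) m₁ 1 1 x ↔ x ∈ aliveStates (k + 1) (m₁.arr 1) := by
        rw [Known, or_iff_left]
        rintro ⟨i, hi, hi', -⟩
        omega
      rw [hx, this, iff_self_and]
      intro hxA
      -- Exactly one state is left, and on a single state the Dirac mass makes it stable.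
      have hxa : x = a := by rwa [hA, Finset.mem_singleton] at hxA
      rw [← hS x hxA, hA, hxa]
      exact stableOn_singleton a
    refine (h₂.runs_markEliminated hn h₁ hlt).mono le_rfl fun m' h' x hx => ?_
    rw [h'.marks, and_iff_right (h₁.complete x hx)]
  -- With `k ≤ n` and lower powers of `n` bounded by `n ^ 3`, the coefficients add up to `50`.
  · nlinarith [Nat.zero_le (k ^ 3), Nat.zero_le (k ^ 2)]

end Machine

/-! ### Stochastic stability -/

namespace Perturbation

variable {I : Set ℝ} {S : Type*} [Fintype S] [DecidableEq S]

theorem neBot_towardsZero (p : Perturbation I S) : (towardsZero I).NeBot := by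
  rw [towardsZero, comap_neBot_iff]
  intro t ht
  obtain ⟨y, ⟨hyt, hyI⟩, -⟩ := accPt_iff_nhds.1 p.index_limit t ht
  exact ⟨⟨y, hyI⟩, hyt⟩

/-- The transition probabilities between numbered states. -/
def rate (p : Perturbation I S) {n : ℕ} (e : Fin n ≃ S) (ε : I) (i j : ℕ) : ℝ :=
  if h : i < n ∧ j < n then p.P ε (e ⟨i, h.1⟩) (e ⟨j, h.2⟩) else 0

theorem rate_nonneg (p : Perturbation I S) {n : ℕ} (e : Fin n ≃ S) (ε : I) (i j : ℕ) :
    0 ≤ p.rate e ε i j := by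
  unfold rate
  split_ifs
  exacts [Matrix.nonneg_of_mem_rowStochastic (p.stochastic ε), le_rfl]

/-- Rows sum to one, so the outflow side of the balance at `y`, diagonal included, is just `μ y`. -/
theorem isStationaryOn_rate_iff (p : Perturbation I S) {n : ℕ} (e : Fin n ≃ S) (ε : I)
    (μ : ℕ → ℝ) : IsStationaryOn (Finset.range n) (p.rate e ε) μ ↔
      IsStationaryDistribution (p.P ε) fun s => μ (e.symm s) := by
  have sum : ∀ F : ℕ → ℝ, ∑ x ∈ Finset.range n, F x = ∑ s, F (e.symm s) := fun F => by
    rw [Finset.sum_range]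
    exact (e.symm.sum_comp fun i : Fin n => F i).symm
  have hr : ∀ s t, p.rate e ε (e.symm s) (e.symm t) = p.P ε s t := fun s t => by simp [rate]
  have all : ∀ φ : ℕ → Prop, (∀ x ∈ Finset.range n, φ x) ↔ ∀ s, φ (e.symm s) := fun φ => by
    refine ⟨fun h s => h _ (by simp), fun h x hx => ?_⟩
    simpa using h (e ⟨x, Finset.mem_range.1 hx⟩)
  have row : ∀ s, ∑ t, p.P ε s t = 1 := Matrix.sum_row_of_mem_rowStochastic (p.stochastic ε)
  have split : IsStationaryOn (Finset.range n) (p.rate e ε) μ ↔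
      ((∀ x ∈ Finset.range n, 0 ≤ μ x) ∧ ∑ x ∈ Finset.range n, μ x = 1) ∧
      ∀ y ∈ Finset.range n, ∑ x ∈ Finset.range n, μ x * p.rate e ε x y =
        μ y * ∑ z ∈ Finset.range n, p.rate e ε y z :=
    ⟨fun h => ⟨⟨h.1, h.2⟩, h.3⟩, fun h => ⟨h.1.1, h.1.2, h.2⟩⟩
  rw [split, all, all]
  simp only [sum, hr, row, mul_one]
  rw [IsStationaryDistribution, funext_iff]
  rfl

/-- A positive liminf amounts to an eventual positive lower bound, the weights being between `0` and
`1`. -/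
theorem isStable_iff_stableOn (p : Perturbation I S) {n : ℕ} (e : Fin n ≃ S) (i : Fin n) :
    p.IsStable (e i) ↔ StableOn (towardsZero I) (Finset.range n) (p.rate e) i := by
  have := p.neBot_towardsZero
  constructor
  · rintro ⟨μ, hμ, hlim⟩
    obtain ⟨c, hc, hcl⟩ := exists_between hlim
    refine ⟨c, hc, (eventually_lt_of_lt_liminf hcl ?_).mono fun ε hε => ?_⟩
    · exact isBoundedUnder_of ⟨0, fun ε => (hμ ε).1.1 _⟩
    · refine ⟨fun x => if h : x < n then μ ε (e ⟨x, h⟩) else 0, ?_, ?_⟩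
      · rw [isStationaryOn_rate_iff]
        simpa using hμ ε
      · simpa using hε.le
  · rintro ⟨c, hc, hs⟩
    -- Stability requires a stationary distribution at every parameter, while the lower bound holds
    -- only eventually: choose one with weight at least `c` where possible and an arbitrary one
    -- elsewhere.
    have ex : ∀ ε, ∃ μ, IsStationaryOn (Finset.range n) (p.rate e ε) μ ∧
        ((∃ μ, IsStationaryOn (Finset.range n) (p.rate e ε) μ ∧ c ≤ μ i) → c ≤ μ i) := by
      intro ε
      by_cases h : ∃ μ, IsStationaryOn (Finset.range n) (p.rate e ε) μ ∧ c ≤ μ i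
      · obtain ⟨μ, h₁, h₂⟩ := h
        exact ⟨μ, h₁, fun _ => h₂⟩
      · obtain ⟨μ, h₁⟩ := exists_isStationaryOn
          (Finset.nonempty_range_iff.2 i.pos.ne') (p.rate_nonneg e ε)
        exact ⟨μ, h₁, fun h' => absurd h' h⟩
    choose μ h₁ h₂ using ex
    refine ⟨fun ε s => μ ε (e.symm s), fun ε => (p.isStationaryOn_rate_iff e ε _).1 (h₁ ε),
      hc.trans_le (le_liminf_of_le ?_ (hs.mono fun ε hε => ?_))⟩
    · refine IsBoundedUnder.isCoboundedUnder_ge (isBoundedUnder_of ⟨1, fun ε => ?_⟩)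
      exact (h₁ ε).le_one (by simp)
    · simpa using h₂ ε hε

theorem represents_rate (p : Perturbation I S) {n : ℕ} (e : Fin n ≃ S)
    {w : ℕ → ℕ → AsympClass I}
    (hw : ∀ i j : Fin n, w i j = AsympClass.mk (p.trans (e i) (e j))) :
    Represents p.mulClosure (Finset.range n) (p.rate e) w := by
  intro x hx y hy hxy
  rw [Finset.mem_range] at hx hy
  refine ⟨p.trans (e ⟨x, hx⟩) (e ⟨y, hy⟩), Subsemigroup.subset_closure ⟨_, _, ?_, rfl⟩,
    hw ⟨x, hx⟩ ⟨y, hy⟩, ?_⟩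
  · simpa using hxy
  · simp only [rate, hx, hy, and_self, dite_true]
    exact isTheta_refl _ _

end Perturbation

theorem theorem1 :
    -- existence of stable states
    (∀ (I : Set ℝ) (S : Type*) [Fintype S] [DecidableEq S] [Nonempty S] (p : Perturbation I S),
      p.TotallyPreordered → ∃ x, p.IsStable x) ∧
    -- one program marks, in the natural-number array `0`, exactly the stable states, in `O(n³)`
    -- steps; its input consists of the classes of the transition maps
    (∃ (prog : Machine.Cmd) (C : ℕ),
      ∀ (I : Set ℝ) (S : Type*) [Fintype S] [DecidableEq S] [Nonempty S] (p : Perturbation I S),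
        p.TotallyPreordered →
        ∀ (n : ℕ) (e : Fin n ≃ S),
          ∃ (t : ℕ) (m : Machine.Memory (AsympClass I)),
            Machine.Exec prog
              (Machine.input fun i j => AsympClass.mk (p.trans (e i) (e j))) t m ∧
            t ≤ C * n ^ 3 ∧
            ∀ i : Fin n, m.arr 0 i = 1 ↔ p.IsStable (e i)) := by
  constructor
  · intro I S _ _ _ p hp
    have e := (Fintype.equivFin S).symm
    have hR := p.represents_rate e (w := fun x y => if h : x < _ ∧ y < _ then
      AsympClass.mk (p.trans (e ⟨x, h.1⟩) (e ⟨y, h.2⟩)) else 0) (by simp)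
    obtain ⟨x, hx, hs⟩ := hR.exists_stableOn (p.rate_nonneg e) hp
      (Finset.nonempty_range_iff.2 Fintype.card_ne_zero)
    exact ⟨e ⟨x, Finset.mem_range.1 hx⟩, (p.isStable_iff_stableOn e ⟨x, _⟩).2 hs⟩
  · refine ⟨Machine.markStable, 50, fun I S _ _ _ p hp n e => ?_⟩
    have hn : 1 ≤ n := Fin.pos (e.symm (Classical.arbitrary S))
    have hA : Machine.aliveStates n (fun _ => 0) = Finset.range n := by
      ext; simp [Machine.mem_aliveStates]
    have key := Machine.runs_markStable (M := p.mulClosure) (n := n) hp hn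
      (m := Machine.input fun i j => AsympClass.mk (p.trans (e i) (e j)))
      -- The bound `x < n` is built in because the marking phase needs stable indices to lie in the
      -- scanned range.
      (St := fun x => x < n ∧ StableOn (towardsZero I) (Finset.range n) (p.rate e) x)
      (fun x h => h.1) ?_ rfl
    · obtain ⟨t, m, h, ht, hm⟩ := key
      refine ⟨t, m, h, ht, fun i => ?_⟩
      rw [hm i i.2, p.isStable_iff_stableOn e i, and_iff_right i.2]
    -- Initially all `n` states are left and no pivot is recorded: the conditions on positions `j`
    -- with `n ≤ j < n` are void.
    · refine ⟨rfl, by simp [Machine.Memory.set], ?_, fun _ => rfl,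
        ⟨p.rate e, p.rate_nonneg e, ?_, ?_⟩, fun j h h' => by omega, fun x hx => .inl ?_,
        fun j h h' => by omega⟩
      · exact (congrArg Finset.card hA).trans (Finset.card_range n)
      · change Represents _ (Machine.aliveStates n fun _ => 0) _ _
        rw [hA]
        exact p.represents_rate e fun i j => by simp [Machine.Memory.set, Machine.input]
      · change ∀ x ∈ Machine.aliveStates n fun _ => 0,
          StableOn _ (Machine.aliveStates n fun _ => 0) _ _ ↔ _
        rw [hA]
        exact fun x hx => (and_iff_right (Finset.mem_range.1 hx)).symm
      · change x ∈ Machine.aliveStates n fun _ => 0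
        rw [hA]
        exact Finset.mem_range.2 hx
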